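/- **Setting.** The combinatorial pentagonal subdivision replaces a pentagon by six pentagons: each edge is divided by its midpoint, a new central pentagon is placed inside, its $i$-th corner is joined by an edge to the midpoint of the $i$-th old edge, and each old corner thus lies in one of the five outer pentagons. Let $K_0$ be a single pentagon, $K_n$ its $n$-th subdivision, and $K=\varinjlim K_n$ the direct limit along the embeddings $K_n\to K_{n+1}$ that map central pentagon to central pentagon. Let the tiles (pentagons) of $K$ carry an arbitrary fixed decoration: the symmetry group of the regular pentagon acts on a set of decorations, and every tile, identified with the regular pentagon, has one of them. We consider decorated pentagonal complexes $L$ that are homeomorphic to the plane and *locally isomorphic to $K$*: every patch (finite set of tiles) of $L$ is isomorphic to a patch of $K$ by a cell-preserving and decoration-preserving map. Each tile of $L$ is regarded as a regular Euclidean pentagon with unit sides, and $d_L$ is the resulting path metric on $L$ (the infimum of the lengths of paths). Cell-preserving maps are understood to be isometric on every cell (induced, on each tile they meet, by an isometry onto a tile). For a point $x\in L$ let $B(x,r,L)=\{y: d_L(x,y)\le r\}$; for a vertex $v$ of $L$ let $B'(v,r,L)$ be the subcomplex that consists of $v$ and of all tiles whose five vertices are within edge-distance $r$ of $v$. Let $\Omega$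 (the continuous hull) be the set of isomorphism classes $[L,x]$ of such $L$ with a point $x\in L$, where $[L,x]=[L',x']$ if there is a cell-preserving and decoration-preserving bijection $L\to L'$, isometric on each cell, that maps $x$ to $x'$. Let $\Xi\subset\Omega$ (the discrete hull) be the set of classes $[L,v]$ with $v$ a vertex of $L$. For two elements of $\Omega$ put $$d([L,x],[L',x'])=\min\bigl(\tfrac1{\sqrt2},\inf\Lambda\bigr),$$ where $\varepsilon>0$ belongs to $\Lambda$ if there are maps $\phi:B(x,1/\varepsilon,L)\to L'$ and $\phi':B(x',1/\varepsilon,L')\to L$ that are cell-preserving, isometries (for $d_L,d_{L'}$), preserve the decorations and the degrees of the vertices, and satisfy $d_{L'}(\phi(x),x')\le\varepsilon$ and $d_L(\phi'(x'),x)\le\varepsilon$. For two elements of $\Xi$ put $$d'([L,v],[L',v'])=\min\bigl(\tfrac1{\sqrt2},\inf\Lambda'\bigr),$$ where $\varepsilon>0$ belongs to $\Lambda'$ if there are maps $\phi:B'(v,1/\varepsilon,L)\to L'$ and $\phi':B'(v',1/\varepsilon,L')\to L$ that are injective, cell-preserving, preserve the decorations and the degrees of the vertices, and satisfy $\phi(v)=v'$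 and $\phi'(v')=v$. (The infimum of the empty set is $+\infty$.) **Theorem.** On $\Xi$ the combinatorial metric $d'$ and the restriction of $d$ are equivalent. More precisely, for all $\xi,\eta\in\Xi$, $$d'(\xi,\eta)\le d(\xi,\eta)\le 18\,d'(\xi,\eta).$$ -/

import Mathlib

noncomputable section

namespace PentHull

open Set

/-! ### The regular Euclidean pentagon with unit sides -/

/-- The corners, in cyclic order, of a regular pentagon with side length one centred at `0`. -/
def corner (i : Fin 5) : ℂ :=
  ((1 / (2 * Real.sin (Real.pi / 5)) : ℝ) : ℂ) *
    Complex.exp (2 * Real.pi * ((i : ℕ) : ℂ) / 5 * Complex.I)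

/-- The closed regular pentagon with unit sides. -/
def pentagon : Set ℂ := convexHull ℝ (range corner)

/-- The symmetry group of the regular pentagon (the dihedral group of order ten). -/
def PentSym : Subgroup (ℂ ≃ₗᵢ[ℝ] ℂ) where
  carrier := {A | A '' range corner = range corner}
  one_mem' := by simp
  mul_mem' := by
    intro A B hA hB
    have h : (⇑(A * B) : ℂ → ℂ) = A ∘ B := rfl
    simp only [mem_ofPred_eq] at hA hB ⊢
    rw [h, image_comp, hB, hA]
  inv_mem' := by
    intro A hA
    simp only [mem_ofPred_eq] at hA ⊢
    have h : (⇑(A⁻¹) : ℂ → ℂ) = A.symm := rfl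
    rw [h]
    conv_lhs => rw [← hA]
    rw [← image_comp]
    have : (A.symm : ℂ → ℂ) ∘ A = id := by
      funext z
      simp
    rw [this, image_id]

theorem image_pentagon (A : PentSym) : (A : ℂ ≃ₗᵢ[ℝ] ℂ) '' pentagon = pentagon := by
  have hA : (A : ℂ ≃ₗᵢ[ℝ] ℂ) '' range corner = range corner := A.2
  have h := (((A : ℂ ≃ₗᵢ[ℝ] ℂ).toLinearEquiv : ℂ ≃ₗ[ℝ] ℂ) : ℂ →ₗ[ℝ] ℂ).image_convexHull
    (range corner)
  have h' : (A : ℂ ≃ₗᵢ[ℝ] ℂ) '' convexHull ℝ (range corner)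
      = convexHull ℝ ((A : ℂ ≃ₗᵢ[ℝ] ℂ) '' range corner) := h
  rw [pentagon, h', hA]

/-- A symmetry of the pentagon, as a map from the pentagon to itself. -/
def act (A : PentSym) (p : pentagon) : pentagon :=
  ⟨(A : ℂ ≃ₗᵢ[ℝ] ℂ) p, (image_pentagon A).subset (mem_image_of_mem _ p.2)⟩

theorem act_mem_interior (A : PentSym) (p : pentagon) (hp : (p : ℂ) ∈ interior pentagon) :
    (act A p : ℂ) ∈ interior pentagon := by
  have h := (A : ℂ ≃ₗᵢ[ℝ] ℂ).toHomeomorph.image_interior pentagon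
  have h' : (A : ℂ ≃ₗᵢ[ℝ] ℂ) '' interior pentagon
      = interior ((A : ℂ ≃ₗᵢ[ℝ] ℂ) '' pentagon) := h
  rw [image_pentagon A] at h'
  rw [← h']
  exact mem_image_of_mem _ hp

/-- A corner as a point of the pentagon. -/
def cornerPt (i : Fin 5) : pentagon := ⟨corner i, subset_convexHull ℝ _ (mem_range_self i)⟩

/-! ### Pentagonal complexes and their piecewise affine realization -/

/-- Combinatorial data for a two-dimensional complex made of pentagons: every tile `t` has five
corners `vert t 0, …, vert t 4`, listed in cyclic order. Only the elements of `V` that are corners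
of some tile play a role; an edge is a pair of cyclically consecutive corners of a tile, and two
tiles share an edge when it has the same end points in both. -/
structure PentComplex where
  V : Type
  T : Type
  vert : T → Fin 5 → V

namespace PentComplex

variable (C : PentComplex)

/-- The pair `(t, p)` is the boundary point `(1 - s) u + s w` of the edge with end points `u, w`,
written as a formal combination of vertices. -/
def BoundaryCoord (a : Σ _ : C.T, pentagon) (c : C.V →₀ ℝ) : Prop :=
  ∃ i : Fin 5, ∃ s : ℝ, 0 ≤ s ∧ s ≤ 1 ∧
    (a.2 : ℂ) = ((1 - s : ℝ) : ℂ) * corner i + (s : ℂ) * corner (i + 1) ∧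
    c = Finsupp.single (C.vert a.1 i) (1 - s) + Finsupp.single (C.vert a.1 (i + 1)) s

/-- The pasting of the unit pentagons along common vertices and common edges. -/
def Glue (a b : Σ _ : C.T, pentagon) : Prop :=
  ∃ c : C.V →₀ ℝ, C.BoundaryCoord a c ∧ C.BoundaryCoord b c

/-- The space obtained by pasting one regular unit pentagon for every tile. -/
def Point : Type := Quot C.Glue

/-- The topology of the complex: the quotient topology of the disjoint union of the pentagons. -/
instance : TopologicalSpace C.Point :=
  inferInstanceAs (TopologicalSpace (Quot C.Glue))

variable {C}

/-- The point of the complex that has position `p` in the tile `t`. -/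
def pt (t : C.T) (p : pentagon) : C.Point := Quot.mk _ ⟨t, p⟩

/-- The `i`-th corner of the tile `t`, as a point of the complex. -/
def vtx (t : C.T) (i : Fin 5) : C.Point := pt t (cornerPt i)

/-- The vertices (zero-cells) among the points of the complex. -/
def IsVertex (x : C.Point) : Prop := ∃ t : C.T, ∃ i : Fin 5, vtx t i = x

/-- The degree of a vertex, counted by the tiles around it; around a vertex of a tiling of the
plane there are as many tiles as edges. -/
def degree (x : C.Point) : ℕ∞ := {t : C.T | ∃ i : Fin 5, vtx t i = x}.encard

/-- `PathLength x y l`: a broken line from `x` to `y`, each of whose segments is a straight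
segment in one tile, has length `l`. -/
inductive PathLength : C.Point → C.Point → ℝ → Prop
  | refl (x : C.Point) : PathLength x x 0
  | step (t : C.T) (p q : pentagon) (y : C.Point) (l : ℝ) (h : PathLength (pt t q) y l) :
      PathLength (pt t p) y (dist p q + l)

/-- The metric of the piecewise affine complex: the infimum of the lengths of the paths. -/
def affDist (x y : C.Point) : ℝ := sInf {l | PathLength x y l}

/-- The closed ball of the metric `affDist`. -/
def affBall (x : C.Point) (r : ℝ) : Set C.Point := {y | affDist x y ≤ r}

variable (C) in
/-- The one-skeleton as a graph: two vertices are adjacent when an edge joins them. -/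
def skeleton : SimpleGraph C.Point :=
  SimpleGraph.fromRel fun x y => ∃ t : C.T, ∃ i : Fin 5, x = vtx t i ∧ y = vtx t (i + 1)

/-- `y` is within edge-distance `r` of `x`. -/
def WithinEdgeDist (x y : C.Point) (r : ℝ) : Prop :=
  ∃ w : C.skeleton.Walk x y, (w.length : ℝ) ≤ r

/-- The subcomplex formed by a set of tiles. -/
def region (P : Set C.T) : Set C.Point := {x | ∃ t ∈ P, ∃ p : pentagon, pt t p = x}

/-- The combinatorial ball: the subcomplex formed by `v` and by the tiles all of whose vertices
are within edge-distance `r` of `v`. -/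
def combBall (v : C.Point) (r : ℝ) : Set C.Point :=
  insert v (region {t : C.T | ∀ i : Fin 5, WithinEdgeDist v (vtx t i) r})

/-- The open tile `t` meets `S`. -/
def Meets (t : C.T) (S : Set C.Point) : Prop :=
  ∃ p : pentagon, (p : ℂ) ∈ interior pentagon ∧ pt t p ∈ S

end PentComplex

open PentComplex

/-! ### The combinatorial pentagonal tiling `K` -/

/-- A single pentagon. -/
def onePentagon : PentComplex where
  V := Fin 5
  T := Unit
  vert := fun _ i => i

/-- The pentagonal subdivision. The vertices are the old vertices, the midpoints of the old edges
and, inside every old tile, five new vertices, the `i`-th of which is joined to the midpoint of the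
edge from corner `i` to corner `i + 1`. Every old tile is replaced by a central pentagon and by
five pentagons, one at each corner. -/
def subdivide (C : PentComplex) : PentComplex where
  V := C.V ⊕ Sym2 C.V ⊕ (C.T × Fin 5)
  T := C.T × Option (Fin 5)
  vert := fun t => match t with
    | (t, none) => fun i => Sum.inr (Sum.inr (t, i))
    | (t, some i) =>
      ![Sum.inl (C.vert t i),
        Sum.inr (Sum.inl s(C.vert t i, C.vert t (i + 1))),
        Sum.inr (Sum.inr (t, i)),
        Sum.inr (Sum.inr (t, i - 1)),
        Sum.inr (Sum.inl s(C.vert t (i - 1), C.vert t i))]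

/-- Maps of complexes that respect the listing of the corners. -/
structure Hom (C C' : PentComplex) where
  onV : C.V → C'.V
  onT : C.T → C'.T
  vert_onT : ∀ t i, C'.vert (onT t) i = onV (C.vert t i)

/-- The subdivision of a map. -/
def Hom.subdivide {C C' : PentComplex} (f : Hom C C') :
    Hom (PentHull.subdivide C) (PentHull.subdivide C') where
  onV := Sum.map f.onV (Sum.map (Sym2.map f.onV) (Prod.map f.onT id))
  onT := Prod.map f.onT id
  vert_onT := by
    rintro ⟨t, _ | j⟩ i
    · rfl
    · fin_cases i <;> simp [PentHull.subdivide, f.vert_onT]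

/-- `Kn n` is the `n`-th subdivision of a pentagon. -/
def Kn : ℕ → PentComplex
  | 0 => onePentagon
  | n + 1 => subdivide (Kn n)

/-- The embedding of `Kn n` in `Kn (n + 1)` that maps the central pentagon to the central
pentagon: the `n`-th subdivision of the inclusion of the central pentagon in `Kn 1`. -/
def incl : (n : ℕ) → Hom (Kn n) (Kn (n + 1))
  | 0 =>
    { onV := fun i => Sum.inr (Sum.inr ((), i))
      onT := fun t => (t, none)
      vert_onT := fun _ _ => rfl }
  | n + 1 => (incl n).subdivide

/-- The direct limit of the complexes `Kn n` along the embeddings `incl n`. -/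
def K : PentComplex where
  V := Quot fun a b : (Σ n, (Kn n).V) => b = ⟨a.1 + 1, (incl a.1).onV a.2⟩
  T := Quot fun a b : (Σ n, (Kn n).T) => b = ⟨a.1 + 1, (incl a.1).onT a.2⟩
  vert := Quot.lift (fun a i => Quot.mk _ ⟨a.1, (Kn a.1).vert a.2 i⟩) (by
    rintro ⟨n, t⟩ b rfl
    funext i
    refine Quot.sound ?_
    simp only [(incl n).vert_onT])

/-! ### Decorated complexes and cell-preserving maps -/

variable {D : Type*} [MulAction PentSym D]

/-- A complex whose tiles carry decorations. The elements of `D` are the decorations of the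
standard pentagon, on which its symmetries act; `dec t` is the decoration of the tile `t`, seen
through its identification with the standard pentagon. -/
structure DecComplex (D : Type*) extends PentComplex where
  dec : T → D

/-- `φ`, considered on `S`, is cell-preserving, isometric on every cell and preserves
decorations: on every tile that it meets it is induced by an isometry onto a tile with the same
decoration, which then maps vertices to vertices and edges to edges. -/
def IsCellMapOn {L M : DecComplex D} (φ : L.Point → M.Point) (S : Set L.Point) : Prop :=
  ∀ t : L.T, Meets t S → ∃ t' : M.T, ∃ A : PentSym, M.dec t' = A • L.dec t ∧
    ∀ p : pentagon, pt t p ∈ S → φ (pt t p) = pt t' (act A p)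

/-- `φ` preserves the degrees of the vertices in `S`. -/
def PreservesDegreeOn {L M : DecComplex D} (φ : L.Point → M.Point) (S : Set L.Point) : Prop :=
  ∀ y ∈ S, IsVertex y → degree (φ y) = degree y

/-- Every patch (finite set of tiles) of `L` is isomorphic to a patch of `M`, by a
cell-preserving and decoration-preserving map. -/
def LocallyIsomorphic (L M : DecComplex D) : Prop :=
  ∀ P : Set L.T, P.Finite → ∃ φ : L.Point → M.Point,
    InjOn φ (region P) ∧ IsCellMapOn φ (region P)

/-- The tiling `K` with the decoration `κ`. -/
def decK (κ : K.T → D) : DecComplex D where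
  toPentComplex := K
  dec := κ

/-! ### The continuous hull and the discrete hull -/

/-- A tiling of the plane, locally isomorphic to the decorated tiling `K`, with a base point. -/
structure PointedTiling (κ : K.T → D) where
  L : DecComplex D
  plane : Nonempty (L.Point ≃ₜ EuclideanSpace ℝ (Fin 2))
  locallyIsomorphic : LocallyIsomorphic L (decK κ)
  x : L.Point

variable {κ : K.T → D}

/-- Isomorphism of pointed tilings: a cell-preserving, decoration-preserving bijection, isometric
on every cell, that maps base point to base point. -/
def PointedTiling.Iso (a b : PointedTiling κ) : Prop :=
  ∃ φ : a.L.Point ≃ b.L.Point, IsCellMapOn φ univ ∧ IsCellMapOn φ.symm univ ∧ φ a.x = b.x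

theorem IsCellMapOn.comp_univ {L M N : DecComplex D} {φ : L.Point → M.Point}
    {ψ : M.Point → N.Point} (hψ : IsCellMapOn ψ univ) (hφ : IsCellMapOn φ univ) :
    IsCellMapOn (ψ ∘ φ) univ := by
  rintro t ⟨p, hp, -⟩
  obtain ⟨t', A, hA, hφt⟩ := hφ t ⟨p, hp, mem_univ _⟩
  obtain ⟨t'', B, hB, hψt⟩ := hψ t' ⟨act A p, act_mem_interior A p hp, mem_univ _⟩
  refine ⟨t'', B * A, ?_, ?_⟩
  · rw [hB, hA, mul_smul]
  · intro q _
    rw [Function.comp_apply, hφt q (mem_univ _), hψt _ (mem_univ _)]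
    rfl

instance pointedSetoid (κ : K.T → D) : Setoid (PointedTiling κ) where
  r := PointedTiling.Iso
  iseqv :=
    { refl := fun a => by
        have h : IsCellMapOn (L := a.L) (M := a.L) (fun y => y) univ :=
          fun t _ => ⟨t, 1, (one_smul _ _).symm, fun p _ => rfl⟩
        exact ⟨Equiv.refl _, h, h, rfl⟩
      symm := by
        rintro a b ⟨φ, h1, h2, h3⟩
        exact ⟨φ.symm, h2, h1, by rw [← h3, Equiv.symm_apply_apply]⟩
      trans := by
        rintro a b c ⟨φ, h1, h2, h3⟩ ⟨ψ, k1, k2, k3⟩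
        exact ⟨φ.trans ψ, k1.comp_univ h1, h2.comp_univ k2, by
          rw [Equiv.trans_apply, h3, k3]⟩ }

/-- The continuous hull: isomorphism classes of pointed tilings locally isomorphic to `K`. -/
def Omega (κ : K.T → D) : Type _ := Quotient (pointedSetoid κ)

/-- The isomorphism class of a pointed tiling. -/
def cls (a : PointedTiling κ) : Omega κ := Quotient.mk (pointedSetoid κ) a

/-- The discrete hull: the classes of the tilings that are pointed at a vertex. -/
def Xi (κ : K.T → D) : Set (Omega κ) := {ξ | ∃ a : PointedTiling κ, IsVertex a.x ∧ cls a = ξ}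

/-! ### The metrics -/

/-- Half of the condition for `d ≤ ε`: a cell-preserving, decoration-preserving and
degree-preserving isometry of the metric ball of radius `1 / ε` around the base point of `a` into
`b`, which moves the base point to within `ε` of the base point of `b`. -/
def ContAgree (a b : PointedTiling κ) (ε : ℝ) : Prop :=
  ∃ φ : a.L.Point → b.L.Point,
    IsCellMapOn φ (affBall a.x (1 / ε)) ∧
    PreservesDegreeOn φ (affBall a.x (1 / ε)) ∧
    (∀ y ∈ affBall a.x (1 / ε), ∀ z ∈ affBall a.x (1 / ε),
      affDist (φ y) (φ z) = affDist y z) ∧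
    affDist (φ a.x) b.x ≤ ε

/-- Half of the condition for `d' ≤ ε`: a cell-preserving, decoration-preserving and
degree-preserving embedding of the combinatorial ball of radius `1 / ε` around the base vertex of
`a` into `b`, which maps base vertex to base vertex. -/
def DiscAgree (a b : PointedTiling κ) (ε : ℝ) : Prop :=
  ∃ φ : a.L.Point → b.L.Point,
    IsCellMapOn φ (combBall a.x (1 / ε)) ∧
    PreservesDegreeOn φ (combBall a.x (1 / ε)) ∧
    InjOn φ (combBall a.x (1 / ε)) ∧
    φ a.x = b.x

/-- The metric `d` of the continuous hull, the smaller one of `1 / √2` and the infimum of the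
`ε > 0` for which the two pointed tilings agree up to `ε`. -/
def dCont (ξ η : Omega κ) : ℝ :=
  sInf (insert (1 / √2) {ε : ℝ | 0 < ε ∧ ∃ a b : PointedTiling κ, cls a = ξ ∧ cls b = η ∧
    ContAgree a b ε ∧ ContAgree b a ε})

/-- The combinatorial metric `d'` of the discrete hull. -/
def dDisc (ξ η : Xi κ) : ℝ :=
  sInf (insert (1 / √2) {ε : ℝ | 0 < ε ∧ ∃ a b : PointedTiling κ, cls a = ξ ∧ cls b = η ∧
    DiscAgree a b ε ∧ DiscAgree b a ε})

end PentHull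

end

/-! Each inequality turns one kind of partial map into the other.

For `dDisc ≤ dCont`, let `φ` be an isometric cell map on the metric ball of radius `1 / ε`, with `ε
< 1`, and let `ε' > ε`. The corners of a tile of the combinatorial ball of radius `1 / ε'` have path
distance at most `1 / ε' < 1 / ε` from the base vertex. So the metric ball contains a piece of the
tile around every corner, and the tile isometry that induces `φ` on this piece extends `φ` to the
whole tile. The extension is well defined and injective because `φ` is an isometry, distinct
vertices have distance at least `1`, and an interior point has positive distance from all other
tiles. The base vertex goes to a vertex at distance at most `ε < 1` from the other base vertex,
hence to that vertex. This is `ContAgree.discAgree`.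

For `dCont ≤ 18 * dDisc`, the key bound is that edge distance is at most four times path distance
plus two (`HasDistinctCorners.withinEdgeDist`). Hence a combinatorial ball of radius `18 * r`
contains, with their neighbouring tiles, all tiles met by nearly shortest paths between points of
the metric ball of radius `r`. A cell map carries such paths forward without changing their length.
Conversely, degrees are finite and preserved, so an injective cell map is onto around each vertex
and paths lift (`IsTileMapOn.exists_pathLength`). So the map is an isometry on the small ball
(`DiscAgree.contAgree`). -/

noncomputable section

namespace PentHull

open Set PentComplex

/-! ### Geometry of the regular pentagon -/

/-- The circumradius of the regular pentagon with unit sides. -/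
def circumradius : ℝ := 1 / (2 * Real.sin (Real.pi / 5))

theorem sin_pi_div_five_pos : 0 < Real.sin (Real.pi / 5) :=
  Real.sin_pos_of_pos_of_lt_pi (by positivity) (by linarith [Real.pi_pos])

theorem circumradius_pos : 0 < circumradius := by
  have := sin_pi_div_five_pos
  unfold circumradius
  positivity

theorem corner_re (i : Fin 5) :
    (corner i).re = circumradius * Real.cos (2 * (Real.pi * (i : ℕ) / 5)) := by
  have h : (2 * Real.pi * ((i : ℕ) : ℂ) / 5 * Complex.I)
      = ((2 * (Real.pi * (i : ℕ) / 5) : ℝ) : ℂ) * Complex.I := by push_cast; ring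
  rw [corner, h, Complex.re_ofReal_mul, Complex.exp_ofReal_mul_I_re, circumradius]

theorem corner_im (i : Fin 5) :
    (corner i).im = circumradius * Real.sin (2 * (Real.pi * (i : ℕ) / 5)) := by
  have h : (2 * Real.pi * ((i : ℕ) : ℂ) / 5 * Complex.I)
      = ((2 * (Real.pi * (i : ℕ) / 5) : ℝ) : ℂ) * Complex.I := by push_cast; ring
  rw [corner, h, Complex.im_ofReal_mul, Complex.exp_ofReal_mul_I_im, circumradius]

theorem dist_sq_eq (z w : ℂ) : dist z w ^ 2 = (z.re - w.re) ^ 2 + (z.im - w.im) ^ 2 := by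
  rw [Complex.dist_eq, Complex.sq_norm, Complex.normSq_apply, Complex.sub_re, Complex.sub_im]
  ring

/-- A chord of a circle of radius `R` has length `2 R |sin|` of half its central angle, and `2 R = 1
/ sin (π / 5)` here. -/
theorem dist_corner_sq_eq_sin (i j : Fin 5) :
    dist (corner i) (corner j) ^ 2 =
      Real.sin (Real.pi * (i : ℕ) / 5 - Real.pi * (j : ℕ) / 5) ^ 2
        / Real.sin (Real.pi / 5) ^ 2 := by
  have h0 := sin_pi_div_five_pos.ne'
  rw [dist_sq_eq, corner_re, corner_re, corner_im, corner_im, Real.sin_sub, circumradius,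
    Real.cos_two_mul, Real.cos_two_mul, Real.sin_two_mul, Real.sin_two_mul]
  set a := Real.pi * (i : ℕ) / 5
  set b := Real.pi * (j : ℕ) / 5
  have ha := Real.sin_sq_add_cos_sq a
  have hb := Real.sin_sq_add_cos_sq b
  field_simp
  generalize Real.sin a = x at *
  generalize Real.cos a = y at *
  generalize Real.sin b = z at *
  generalize Real.cos b = w at *
  have hx : x ^ 2 = 1 - y ^ 2 := by linarith
  have hz : z ^ 2 = 1 - w ^ 2 := by linarith
  ring_nf
  simp only [hx, hz]
  ring

theorem sin_two_pi_div_five_sq :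
    Real.sin (2 * (Real.pi / 5)) ^ 2 / Real.sin (Real.pi / 5) ^ 2 = (3 + √5) / 2 := by
  have h0 := sin_pi_div_five_pos.ne'
  rw [Real.sin_two_mul, Real.cos_pi_div_five]
  field_simp
  nlinarith [Real.sq_sqrt (show (0 : ℝ) ≤ 5 by norm_num)]

theorem dist_corner_sq (i j : Fin 5) : dist (corner i) (corner j) ^ 2 =
    if i = j then 0 else if j = i + 1 ∨ i = j + 1 then 1 else (3 + √5) / 2 := by
  have h0 := sin_pi_div_five_pos.ne'
  have key : ∀ k : ℕ, k < 5 → Real.sin (Real.pi * k / 5) ^ 2 / Real.sin (Real.pi / 5) ^ 2 =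
      if k = 0 then 0 else if k = 1 ∨ k = 4 then 1 else (3 + √5) / 2 := by
    intro k hk
    interval_cases k
    · simp
    · simp [h0]
    · rw [← sin_two_pi_div_five_sq]
      norm_num
      ring_nf
    · have : Real.pi - 2 * (Real.pi / 5) = Real.pi * (3 : ℕ) / 5 := by push_cast; ring
      rw [← sin_two_pi_div_five_sq, ← Real.sin_pi_sub (2 * (Real.pi / 5)), this]
      norm_num
    · rw [← Real.sin_pi_sub]
      have : Real.pi - Real.pi * (4 : ℕ) / 5 = Real.pi / 5 := by push_cast; ring
      rw [this]
      simp [h0]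
  wlog hij : j ≤ i generalizing i j with H
  · rw [dist_comm, H j i (le_of_not_ge hij)]
    simp only [eq_comm (a := i) (b := j), or_comm]
  rw [dist_corner_sq_eq_sin]
  have h1 : Real.pi * (i : ℕ) / 5 - Real.pi * (j : ℕ) / 5
      = Real.pi * ((i : ℕ) - (j : ℕ) : ℕ) / 5 := by
    rw [Nat.cast_sub (by exact_mod_cast hij)]
    ring
  rw [h1, key _ (by omega)]
  have h2 : (i : ℕ) - (j : ℕ) = 0 ↔ i = j := by clear h1; decide +revert
  have h3 : ((i : ℕ) - (j : ℕ) = 1 ∨ (i : ℕ) - (j : ℕ) = 4) ↔ (j = i + 1 ∨ i = j + 1) := by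
    clear h1 h2; decide +revert
  simp only [h2, h3]

theorem sqrt_five_mem : (2.2 : ℝ) < √5 ∧ √5 < 2.3 :=
  ⟨by apply Real.lt_sqrt_of_sq_lt; norm_num, by rw [Real.sqrt_lt'] <;> norm_num⟩

theorem corner_injective : Function.Injective corner := by
  intro i j hij
  by_contra h
  have h1 := dist_corner_sq i j
  have := sqrt_five_mem.1
  rw [hij, dist_self, if_neg h] at h1
  split_ifs at h1 <;> linarith

theorem adjacent_of_dist_corner {i j : Fin 5} (h : dist (corner i) (corner j) = 1) :
    j = i + 1 ∨ i = j + 1 := by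
  by_contra h'
  have h1 := dist_corner_sq i j
  have := sqrt_five_mem.1
  rw [h, if_neg h'] at h1
  split_ifs at h1 <;> linarith

theorem dist_corner_succ (i : Fin 5) : dist (corner i) (corner (i + 1)) = 1 := by
  have h : i ≠ i + 1 := by decide +revert
  have h1 := dist_corner_sq i (i + 1)
  rw [if_neg h, if_pos (Or.inl rfl)] at h1
  nlinarith [dist_nonneg (x := corner i) (y := corner (i + 1))]

/-! ### Distances from the points of an edge to the corners. -/

/-- The point that divides the `j`-th edge in the ratio `s : 1 - s`. -/
def edgePt (j : Fin 5) (s : ℝ) : ℂ :=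
  ((1 - s : ℝ) : ℂ) * corner j + (s : ℂ) * corner (j + 1)

/-- Stewart's theorem for a side of length one. -/
theorem dist_edgePt_sq (j : Fin 5) (s : ℝ) (z : ℂ) :
    dist (edgePt j s) z ^ 2 = (1 - s) * dist (corner j) z ^ 2
      + s * dist (corner (j + 1)) z ^ 2 - s * (1 - s) := by
  have h := dist_corner_succ j
  have h' : dist (corner j) (corner (j + 1)) ^ 2 = 1 := by rw [h]; norm_num
  rw [dist_sq_eq] at h' ⊢
  rw [dist_sq_eq, dist_sq_eq]
  simp only [edgePt, Complex.add_re, Complex.add_im, Complex.re_ofReal_mul, Complex.im_ofReal_mul]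
  linear_combination s * (s - 1) * h'

theorem dist_edgePt_left {j : Fin 5} {s : ℝ} (hs : 0 ≤ s) :
    dist (edgePt j s) (corner j) = s := by
  have h := dist_edgePt_sq j s (corner j)
  rw [dist_comm (corner (j + 1)), dist_corner_succ, dist_self] at h
  rw [← sq_eq_sq₀ dist_nonneg hs, h]
  ring

theorem dist_edgePt_right {j : Fin 5} {s : ℝ} (hs : s ≤ 1) :
    dist (edgePt j s) (corner (j + 1)) = 1 - s := by
  have h := dist_edgePt_sq j s (corner (j + 1))
  rw [dist_corner_succ, dist_self] at h
  rw [← sq_eq_sq₀ dist_nonneg (by linarith), h]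
  ring

/-- The distance from a point of an edge to the corner that follows the edge. -/
theorem le_dist_edgePt_add_two {j : Fin 5} {s : ℝ} (h1 : s ≤ 1) :
    (1 - s) + 1 / 4 ≤ dist (edgePt j s) (corner (j + 2)) ∧
      1 ≤ dist (edgePt j s) (corner (j + 2)) := by
  have h := dist_edgePt_sq j s (corner (j + 2))
  have e1 := (by decide : ∀ j : Fin 5, ¬ j = j + 2 ∧ ¬ (j + 2 = j + 1 ∨ j = j + 2 + 1)) j
  have e2 := (by decide : ∀ j : Fin 5, ¬ j + 1 = j + 2 ∧ (j + 2 = j + 1 + 1 ∨ j + 1 = j + 2 + 1)) j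
  rw [dist_corner_sq, dist_corner_sq, if_neg e1.1, if_neg e1.2, if_neg e2.1, if_pos e2.2] at h
  have := sqrt_five_mem.1
  -- With `u = 1 - s` and `√5 > 2.2` the squared distance is at least `u ^ 2 + 0.6 * u + 1`.
  constructor <;> refine (pow_le_pow_iff_left₀ (by linarith) dist_nonneg two_ne_zero).1 ?_ <;>
    rw [h] <;> nlinarith

/-- The distance from a point of an edge to the corner that precedes the edge. -/
theorem le_dist_edgePt_add_four {j : Fin 5} {s : ℝ} (h0 : 0 ≤ s) :
    s + 1 / 4 ≤ dist (edgePt j s) (corner (j + 4)) ∧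
      1 ≤ dist (edgePt j s) (corner (j + 4)) := by
  have h := dist_edgePt_sq j s (corner (j + 4))
  have e1 := (by decide : ∀ j : Fin 5, ¬ j = j + 4 ∧ (j + 4 = j + 1 ∨ j = j + 4 + 1)) j
  have e2 := (by decide : ∀ j : Fin 5, ¬ j + 1 = j + 4 ∧ ¬ (j + 4 = j + 1 + 1 ∨ j + 1 = j + 4 + 1)) j
  rw [dist_corner_sq, dist_corner_sq, if_neg e1.1, if_pos e1.2, if_neg e2.1, if_neg e2.2] at h
  have := sqrt_five_mem.1
  constructor <;> refine (pow_le_pow_iff_left₀ (by linarith) dist_nonneg two_ne_zero).1 ?_ <;>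
    rw [h] <;> nlinarith

/-- The distance from a point of an edge to the opposite corner. -/
theorem le_dist_edgePt_add_three (j : Fin 5) (s : ℝ) :
    3 / 2 ≤ dist (edgePt j s) (corner (j + 3)) := by
  have h := dist_edgePt_sq j s (corner (j + 3))
  have e1 := (by decide : ∀ j : Fin 5, ¬ j = j + 3 ∧ ¬ (j + 3 = j + 1 ∨ j = j + 3 + 1)) j
  have e2 := (by decide : ∀ j : Fin 5, ¬ j + 1 = j + 3 ∧ ¬ (j + 3 = j + 1 + 1 ∨ j + 1 = j + 3 + 1)) j
  rw [dist_corner_sq, dist_corner_sq, if_neg e1.1, if_neg e1.2, if_neg e2.1, if_neg e2.2] at h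
  have := sqrt_five_mem.1
  refine (pow_le_pow_iff_left₀ (by norm_num) dist_nonneg two_ne_zero).1 ?_
  rw [h]
  nlinarith [sq_nonneg (2 * s - 1)]

theorem fin_five_cases (j k : Fin 5) :
    k = j ∨ k = j + 1 ∨ k = j + 2 ∨ k = j + 3 ∨ k = j + 4 := by
  decide +revert

/-- A function that falls from `1` to `0` with the distance from the `k`-th corner. -/
def hat (k : Fin 5) (z : ℂ) : ℝ := max 0 (1 - dist z (corner k))

theorem hat_sub_le (k : Fin 5) (z w : ℂ) : hat k z - hat k w ≤ dist z w := by
  have h := dist_triangle w z (corner k)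
  have h' := dist_nonneg (x := z) (y := w)
  rw [dist_comm w z] at h
  have h2 : 1 - dist w (corner k) ≤ hat k w := le_max_right _ _
  have h3 : 0 ≤ hat k w := le_max_left _ _
  rw [sub_le_iff_le_add]
  exact max_le (by linarith) (by linarith)

theorem hat_edgePt_left {j : Fin 5} {s : ℝ} (h0 : 0 ≤ s) (h1 : s ≤ 1) :
    hat j (edgePt j s) = 1 - s := by
  rw [hat, dist_edgePt_left h0, max_eq_right (by linarith)]

theorem hat_edgePt_right {j : Fin 5} {s : ℝ} (h0 : 0 ≤ s) (h1 : s ≤ 1) :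
    hat (j + 1) (edgePt j s) = s := by
  rw [hat, dist_edgePt_right h1, max_eq_right (by linarith)]
  ring

/-- The other three corners are at distance at least `1` from the edge. So on the boundary the five
hats are the barycentric coordinates along the edge, and they recover the formal combination of
vertices from the position alone. -/
theorem hat_edgePt_of_ne {j k : Fin 5} {s : ℝ} (h0 : 0 ≤ s) (h1 : s ≤ 1) (hk : k ≠ j)
    (hk' : k ≠ j + 1) : hat k (edgePt j s) = 0 := by
  have h : 1 ≤ dist (edgePt j s) (corner k) := by
    rcases fin_five_cases j k with rfl | rfl | rfl | rfl | rfl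
    · exact absurd rfl hk
    · exact absurd rfl hk'
    · exact (le_dist_edgePt_add_two h1).2
    · linarith [le_dist_edgePt_add_three j s]
    · exact (le_dist_edgePt_add_four h0).2
  rw [hat, max_eq_left (by linarith)]

/-! #### Interior points -/

theorem corner_mem (i : Fin 5) : corner i ∈ pentagon := (cornerPt i).2

theorem convex_pentagon : Convex ℝ pentagon := convex_convexHull ℝ _

/-- The linear function that is maximal on the `j`-th edge. -/
def height (j : Fin 5) (z : ℂ) : ℝ :=
  dist z (corner (j + 3)) ^ 2 - (dist z (corner j) ^ 2 + dist z (corner (j + 1)) ^ 2) / 2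

/-- The quadratic terms of the squared distances cancel, so `height j` is affine. -/
theorem height_combination (j : Fin 5) (z w : ℂ) (a b : ℝ) (hab : a + b = 1) :
    height j (a • z + b • w) = a * height j z + b * height j w := by
  obtain rfl : b = 1 - a := by linarith
  simp only [height, dist_sq_eq, Complex.add_re, Complex.add_im, Complex.real_smul,
    Complex.re_ofReal_mul, Complex.im_ofReal_mul]
  ring

theorem height_corner_le (j k : Fin 5) : height j (corner k) ≤ (2 + √5) / 2 := by
  have := sqrt_five_mem.1
  simp only [height, dist_corner_sq]
  fin_cases j <;> fin_cases k <;> simp <;> linarith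

theorem height_le {z : ℂ} (j : Fin 5) (hz : z ∈ pentagon) : height j z ≤ (2 + √5) / 2 := by
  have h : pentagon ⊆ {z | height j z ≤ (2 + √5) / 2} := by
    refine convexHull_min ?_ ?_
    · rintro _ ⟨k, rfl⟩
      exact height_corner_le j k
    · intro x hx y hy a b ha hb hab
      simp only [mem_ofPred_eq] at hx hy ⊢
      rw [height_combination j x y a b hab]
      calc a * height j x + b * height j y
          ≤ a * ((2 + √5) / 2) + b * ((2 + √5) / 2) := by gcongr
        _ = (2 + √5) / 2 := by rw [← add_mul, hab, one_mul]
  exact h hz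

theorem height_edgePt (j : Fin 5) (s : ℝ) : height j (edgePt j s) = (2 + √5) / 2 := by
  have h := height_combination j (corner j) (corner (j + 1)) (1 - s) s (by ring)
  rw [Complex.real_smul, Complex.real_smul] at h
  rw [edgePt, h]
  have e1 := (by decide : ∀ j : Fin 5, ¬ j = j + 3 ∧ ¬ (j + 3 = j + 1 ∨ j = j + 3 + 1)) j
  have e2 := (by decide : ∀ j : Fin 5, ¬ j + 1 = j + 3 ∧ ¬ (j + 3 = j + 1 + 1 ∨ j + 1 = j + 3 + 1)) j
  have e3 := (by decide : ∀ j : Fin 5, ¬ j = j + 1) j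
  simp only [height, dist_corner_sq, if_neg e1.1, if_neg e1.2, if_neg e2.1, if_neg e2.2,
    if_neg e3, if_neg (Ne.symm e3), true_or, or_true, if_true]
  ring

theorem height_opposite (j : Fin 5) : height j (corner (j + 3)) < (2 + √5) / 2 := by
  have := sqrt_five_mem.1
  have e1 := (by decide : ∀ j : Fin 5, ¬ j + 3 = j ∧ ¬ (j = j + 3 + 1 ∨ j + 3 = j + 1)) j
  have e2 := (by decide : ∀ j : Fin 5, ¬ j + 3 = j + 1 ∧ ¬ (j + 1 = j + 3 + 1 ∨ j + 3 = j + 1 + 1)) j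
  simp only [height, dist_corner_sq, if_neg e1.1, if_neg e1.2, if_neg e2.1, if_neg e2.2, if_true]
  linarith

/-- A small step away from the opposite corner would raise `height j` above its maximum on the
pentagon. -/
theorem edgePt_notMem_interior (j : Fin 5) (s : ℝ) : edgePt j s ∉ interior pentagon := by
  intro h
  have hc : ContinuousAt (fun δ : ℝ => (1 + δ) • edgePt j s + (-δ) • corner (j + 3)) 0 := by
    fun_prop
  have h1 : ∀ᶠ δ : ℝ in nhds 0, (1 + δ) • edgePt j s + (-δ) • corner (j + 3) ∈ pentagon := by
    refine hc (mem_interior_iff_mem_nhds.1 ?_)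
    simpa using h
  obtain ⟨ε, hε, hball⟩ := Metric.eventually_nhds_iff.1 h1
  have h2 := hball (y := ε / 2) (by rw [Real.dist_eq, sub_zero, abs_of_pos] <;> linarith)
  have h3 := height_le j h2
  rw [height_combination j _ _ _ _ (by ring), height_edgePt] at h3
  nlinarith [height_opposite j]

theorem corner_notMem_interior (j : Fin 5) : corner j ∉ interior pentagon := by
  have h := edgePt_notMem_interior j 0
  simpa [edgePt] using h

theorem corner_eq_pow (i : Fin 5) :
    corner i = (circumradius : ℂ) * Complex.exp (2 * Real.pi * Complex.I / 5) ^ (i : ℕ) := by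
  rw [corner, ← Complex.exp_nat_mul, circumradius]
  congr 2
  ring

theorem isPrimitiveRoot_five :
    IsPrimitiveRoot (Complex.exp (2 * Real.pi * Complex.I / 5)) 5 := by
  simpa using Complex.isPrimitiveRoot_exp 5 (by norm_num)

theorem sum_corner : ∑ i, corner i = 0 := by
  have h := isPrimitiveRoot_five.geom_sum_eq_zero (by norm_num)
  simp only [corner_eq_pow]
  rw [← Finset.mul_sum, Fin.sum_univ_eq_sum_range
    (fun i => Complex.exp (2 * Real.pi * Complex.I / 5) ^ i), h, mul_zero]

theorem sum_corner_sq : ∑ i, corner i ^ 2 = 0 := by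
  have h := (isPrimitiveRoot_five.pow_of_coprime 2 (by norm_num)).geom_sum_eq_zero (by norm_num)
  simp only [corner_eq_pow, mul_pow, ← pow_mul, mul_comm _ 2]
  simp only [pow_mul]
  rw [← Finset.mul_sum, Fin.sum_univ_eq_sum_range
    (fun i => (Complex.exp (2 * Real.pi * Complex.I / 5) ^ 2) ^ i), h, mul_zero]

theorem corner_mul_conj (i : Fin 5) :
    corner i * (starRingEnd ℂ) (corner i) = (circumradius : ℂ) ^ 2 := by
  rw [Complex.mul_conj, Complex.normSq_apply, corner_re, corner_im]
  rw [← Complex.ofReal_pow]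
  congr 1
  linear_combination circumradius ^ 2 *
    Real.sin_sq_add_cos_sq (2 * (Real.pi * (i : ℕ) / 5))

theorem norm_corner (i : Fin 5) : ‖corner i‖ = circumradius := by
  have h := corner_mul_conj i
  rw [Complex.mul_conj, Complex.normSq_eq_norm_sq] at h
  have h' : ‖corner i‖ ^ 2 = circumradius ^ 2 := by exact_mod_cast h
  exact (sq_eq_sq₀ (norm_nonneg _) circumradius_pos.le).1 h'

/-- The explicit weights `w` reproduce `z`: the corners sum to zero, and the vanishing of the sum of
their squares removes the term with the conjugate of `z`. The bound on the norm keeps the weights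
nonnegative. -/
theorem mem_pentagon_of_norm_le {z : ℂ} (hz : ‖z‖ ≤ circumradius / 2) : z ∈ pentagon := by
  have hρ := circumradius_pos
  have hρ' : (circumradius : ℂ) ≠ 0 := by exact_mod_cast hρ.ne'
  let w : Fin 5 → ℝ := fun i =>
    1 / 5 + 2 / (5 * circumradius ^ 2) * (z * (starRingEnd ℂ) (corner i)).re
  have hw : ∀ i, (w i : ℂ) = 1 / 5 + 1 / (5 * (circumradius : ℂ) ^ 2) *
      (z * (starRingEnd ℂ) (corner i) + (starRingEnd ℂ) z * corner i) := by
    intro i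
    have h := Complex.add_conj (z * (starRingEnd ℂ) (corner i))
    rw [map_mul, Complex.conj_conj] at h
    rw [h]
    simp only [w]
    push_cast
    ring
  have h0 : ∀ i ∈ Finset.univ, 0 ≤ w i := by
    intro i _
    have h1 := Complex.abs_re_le_norm (z * (starRingEnd ℂ) (corner i))
    rw [norm_mul, RCLike.norm_conj, norm_corner] at h1
    have h2 := (abs_le.1 h1).1
    have h3 : ‖z‖ * circumradius ≤ circumradius ^ 2 / 2 := by nlinarith
    have h4 : 2 / (5 * circumradius ^ 2) * (-(circumradius ^ 2 / 2)) ≤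
        2 / (5 * circumradius ^ 2) * (z * (starRingEnd ℂ) (corner i)).re :=
      mul_le_mul_of_nonneg_left (by linarith) (by positivity)
    have h5 : 2 / (5 * circumradius ^ 2) * (-(circumradius ^ 2 / 2)) = -(1 / 5) := by
      field_simp
    simp only [w]
    linarith
  have hconj : ∑ i, (starRingEnd ℂ) (corner i) = 0 := by
    rw [← map_sum, sum_corner, map_zero]
  have h1 : ∑ i, w i = 1 := by
    have : ((∑ i, w i : ℝ) : ℂ) = 1 := by
      rw [Complex.ofReal_sum]
      simp only [hw]
      rw [Finset.sum_add_distrib, ← Finset.mul_sum, Finset.sum_add_distrib, ← Finset.mul_sum,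
        ← Finset.mul_sum, hconj, sum_corner]
      simp
    exact_mod_cast this
  have h2 : ∑ i, w i • corner i = z := by
    have : ∀ i, w i • corner i = 1 / 5 * corner i + 1 / (5 * (circumradius : ℂ) ^ 2) *
        (z * (circumradius : ℂ) ^ 2 + (starRingEnd ℂ) z * corner i ^ 2) := by
      intro i
      rw [Complex.real_smul, hw, ← corner_mul_conj i]
      ring
    simp only [this]
    rw [Finset.sum_add_distrib, ← Finset.mul_sum, ← Finset.mul_sum, Finset.sum_add_distrib,
      ← Finset.mul_sum (f := fun i => corner i ^ 2), sum_corner, sum_corner_sq]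
    simp
    field_simp
  rw [← h2]
  exact convex_pentagon.sum_mem h0 h1 fun i _ => corner_mem i

theorem interior_pentagon_nonempty : (interior pentagon).Nonempty := by
  refine ⟨0, mem_interior_iff_mem_nhds.2 ?_⟩
  refine Filter.mem_of_superset
    (Metric.closedBall_mem_nhds 0 (half_pos circumradius_pos)) fun z hz => ?_
  exact mem_pentagon_of_norm_le (by simpa using hz)

theorem pentagon_subset_closure_interior : pentagon ⊆ closure (interior pentagon) := by
  rw [convex_pentagon.closure_interior_eq_closure_of_nonempty_interior interior_pentagon_nonempty]
  exact subset_closure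

/-- There are interior points arbitrarily close to a corner. -/
theorem exists_interior_near_corner (i : Fin 5) {δ : ℝ} (hδ : 0 < δ) :
    ∃ p : pentagon, (p : ℂ) ∈ interior pentagon ∧ dist p (cornerPt i) < δ := by
  obtain ⟨z, hz, hd⟩ := Metric.mem_closure_iff.1
    (pentagon_subset_closure_interior (corner_mem i)) δ hδ
  exact ⟨⟨z, interior_subset hz⟩, hz, by rwa [dist_comm] at hd⟩

/-! #### The symmetries -/

theorem exists_perm (A : PentSym) (i : Fin 5) :
    ∃ k, (A : ℂ ≃ₗᵢ[ℝ] ℂ) (corner i) = corner k := by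
  have h : (A : ℂ ≃ₗᵢ[ℝ] ℂ) '' range corner = range corner := A.2
  have h' := h.subset (mem_image_of_mem _ (mem_range_self i))
  obtain ⟨k, hk⟩ := h'
  exact ⟨k, hk.symm⟩

/-- The action of a symmetry of the pentagon on the corners. -/
def perm (A : PentSym) (i : Fin 5) : Fin 5 := (exists_perm A i).choose

theorem apply_corner (A : PentSym) (i : Fin 5) :
    (A : ℂ ≃ₗᵢ[ℝ] ℂ) (corner i) = corner (perm A i) := (exists_perm A i).choose_spec

theorem act_cornerPt (A : PentSym) (i : Fin 5) : act A (cornerPt i) = cornerPt (perm A i) :=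
  Subtype.ext (apply_corner A i)

theorem act_mul (A B : PentSym) (p : pentagon) : act (A * B) p = act A (act B p) := rfl

theorem act_one (p : pentagon) : act 1 p = p := rfl

theorem act_inv_act (A : PentSym) (p : pentagon) : act A⁻¹ (act A p) = p := by
  rw [← act_mul, inv_mul_cancel, act_one]

theorem act_act_inv (A : PentSym) (p : pentagon) : act A (act A⁻¹ p) = p := by
  rw [← act_mul, mul_inv_cancel, act_one]

theorem dist_act (A : PentSym) (p q : pentagon) : dist (act A p) (act A q) = dist p q :=
  (A : ℂ ≃ₗᵢ[ℝ] ℂ).dist_map p q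

theorem perm_perm_inv (A : PentSym) (i : Fin 5) : perm A (perm A⁻¹ i) = i := by
  apply corner_injective
  have h := act_act_inv A (cornerPt i)
  rw [act_cornerPt, act_cornerPt] at h
  exact congrArg Subtype.val h

/-- Only adjacent corners have distance `1`. The second alternative is that of the reflections. -/
theorem perm_succ (A : PentSym) (i : Fin 5) :
    perm A (i + 1) = perm A i + 1 ∨ perm A i = perm A (i + 1) + 1 := by
  apply adjacent_of_dist_corner
  rw [← apply_corner, ← apply_corner, LinearIsometryEquiv.dist_map, dist_corner_succ]

theorem apply_edgePt (A : PentSym) (j : Fin 5) (s : ℝ) :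
    (A : ℂ ≃ₗᵢ[ℝ] ℂ) (edgePt j s) =
      ((1 - s : ℝ) : ℂ) * corner (perm A j) + (s : ℂ) * corner (perm A (j + 1)) := by
  rw [edgePt, ← Complex.real_smul, ← Complex.real_smul, map_add, map_smul, map_smul,
    apply_corner, apply_corner, Complex.real_smul, Complex.real_smul]

namespace PentComplex

variable {C : PentComplex}

/-! ### Points of a complex -/

theorem BoundaryCoord.eq_sum {a : Σ _ : C.T, pentagon} {c : C.V →₀ ℝ} (h : C.BoundaryCoord a c) :
    c = ∑ k, Finsupp.single (C.vert a.1 k) (hat k a.2) := by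
  obtain ⟨i, s, h0, h1, hp, rfl⟩ := h
  change (a.2 : ℂ) = edgePt i s at hp
  have hne : i ≠ i + 1 := by clear hp; decide +revert
  rw [Fintype.sum_eq_add i (i + 1) hne, hp, hat_edgePt_left h0 h1, hat_edgePt_right h0 h1]
  rintro k ⟨hk, hk'⟩
  rw [hp, hat_edgePt_of_ne h0 h1 hk hk', Finsupp.single_zero]

theorem BoundaryCoord.unique {a : Σ _ : C.T, pentagon} {c c' : C.V →₀ ℝ}
    (h : C.BoundaryCoord a c) (h' : C.BoundaryCoord a c') : c = c' := by
  rw [h.eq_sum, h'.eq_sum]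

theorem BoundaryCoord.notMem_interior {a : Σ _ : C.T, pentagon} {c : C.V →₀ ℝ}
    (h : C.BoundaryCoord a c) : (a.2 : ℂ) ∉ interior pentagon := by
  obtain ⟨i, s, -, -, hp, -⟩ := h
  rw [hp]
  exact edgePt_notMem_interior i s

theorem boundaryCoord_corner (t : C.T) (i : Fin 5) :
    C.BoundaryCoord ⟨t, cornerPt i⟩ (Finsupp.single (C.vert t i) 1) :=
  ⟨i, 0, le_rfl, zero_le_one, by simp [cornerPt], by simp⟩

theorem BoundaryCoord.exists_vert_mem_support {a : Σ _ : C.T, pentagon} {c : C.V →₀ ℝ}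
    (h : C.BoundaryCoord a c) : ∃ k, C.vert a.1 k ∈ c.support := by
  classical
  obtain ⟨i, s, h0, h1, -, rfl⟩ := h
  rcases h1.lt_or_eq with h1 | rfl
  · refine ⟨i, ?_⟩
    rw [Finsupp.mem_support_iff, Finsupp.add_apply, Finsupp.single_eq_same]
    -- The two ends of the edge are not known to be distinct here; if they coincide, the
    -- coefficients add up and do not cancel.
    have : 0 ≤ Finsupp.single (C.vert a.1 (i + 1)) s (C.vert a.1 i) := by
      rw [Finsupp.single_apply]
      split_ifs <;> linarith
    linarith
  · exact ⟨i + 1, by simp⟩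

theorem BoundaryCoord.exists_vert_of_mem_support {a : Σ _ : C.T, pentagon} {c : C.V →₀ ℝ}
    (h : C.BoundaryCoord a c) {w : C.V} (hw : w ∈ c.support) : ∃ k, C.vert a.1 k = w := by
  by_contra hk
  push Not at hk
  rw [h.eq_sum, Finsupp.mem_support_iff, Finsupp.finsetSum_apply] at hw
  exact hw (Finset.sum_eq_zero fun k _ => Finsupp.single_eq_of_ne (hk k).symm)

/-- By uniqueness of the boundary coordinate `Glue` is already transitive, so the generated
equivalence adds only the diagonal. -/
theorem pt_eq_pt_iff {t t' : C.T} {p q : pentagon} : (pt t p : C.Point) = pt t' q ↔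
    (⟨t, p⟩ : Σ _ : C.T, pentagon) = ⟨t', q⟩ ∨ C.Glue ⟨t, p⟩ ⟨t', q⟩ := by
  constructor
  · intro h
    have h' := Quot.eqvGen_exact h
    generalize (⟨t, p⟩ : Σ _ : C.T, pentagon) = a at h'
    generalize (⟨t', q⟩ : Σ _ : C.T, pentagon) = b at h'
    clear h
    induction h' with
    | rel _ _ h => exact Or.inr h
    | refl _ => exact Or.inl rfl
    | symm _ _ _ ih =>
      rcases ih with rfl | ⟨c, h1, h2⟩
      · exact Or.inl rfl
      · exact Or.inr ⟨c, h2, h1⟩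
    | trans _ _ _ _ _ ih ih' =>
      rcases ih with rfl | ⟨c, h1, h2⟩
      · exact ih'
      rcases ih' with rfl | ⟨c', h3, h4⟩
      · exact Or.inr ⟨c, h1, h2⟩
      obtain rfl := h2.unique h3
      exact Or.inr ⟨c, h1, h4⟩
  · rintro (h | h)
    · cases h
      rfl
    · exact Quot.sound h

theorem vtx_eq_vtx_iff {t t' : C.T} {i j : Fin 5} :
    (vtx t i : C.Point) = vtx t' j ↔ C.vert t i = C.vert t' j := by
  constructor
  · intro h
    rcases pt_eq_pt_iff.1 h with h | ⟨c, h1, h2⟩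
    · obtain ⟨h1, h2⟩ := Sigma.mk.inj_iff.1 h
      rw [h1, corner_injective (congrArg Subtype.val (eq_of_heq h2))]
    · have := (h1.unique (boundaryCoord_corner t i)).symm.trans
        (h2.unique (boundaryCoord_corner t' j))
      exact Finsupp.single_left_injective one_ne_zero this
  · intro h
    have h2 := boundaryCoord_corner t' j
    rw [← h] at h2
    exact Quot.sound ⟨_, boundaryCoord_corner t i, h2⟩

theorem eq_of_pt_eq_of_mem_interior {t t' : C.T} {p q : pentagon}
    (hp : (p : ℂ) ∈ interior pentagon) (h : (pt t p : C.Point) = pt t' q) : t = t' ∧ p = q := by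
  rcases pt_eq_pt_iff.1 h with h | ⟨c, h1, -⟩
  · obtain ⟨h1, h2⟩ := Sigma.mk.inj_iff.1 h
    exact ⟨h1, eq_of_heq h2⟩
  · exact absurd hp h1.notMem_interior

theorem eq_or_exists_vtx_eq {t t' : C.T} {p q : pentagon} (h : (pt t p : C.Point) = pt t' q) :
    t = t' ∨ ∃ i j, (vtx t i : C.Point) = vtx t' j := by
  rcases pt_eq_pt_iff.1 h with h | ⟨c, h1, h2⟩
  · exact Or.inl (Sigma.mk.inj_iff.1 h).1
  · obtain ⟨i, hi⟩ := h1.exists_vert_mem_support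
    obtain ⟨j, hj⟩ := h2.exists_vert_of_mem_support hi
    exact Or.inr ⟨i, j, vtx_eq_vtx_iff.2 hj.symm⟩

theorem exists_pt (x : C.Point) : ∃ t p, pt t p = x := by
  obtain ⟨⟨t, p⟩, rfl⟩ := Quot.exists_rep x
  exact ⟨t, p, rfl⟩

theorem meets_univ (t : C.T) : Meets t (univ : Set C.Point) := by
  obtain ⟨z, hz⟩ := interior_pentagon_nonempty
  exact ⟨⟨z, interior_subset hz⟩, hz, mem_univ _⟩

theorem Meets.mono {t : C.T} {S S' : Set C.Point} (h : Meets t S) (hS : S ⊆ S') : Meets t S' := by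
  obtain ⟨p, hp, h⟩ := h
  exact ⟨p, hp, hS h⟩

theorem meets_region {P : Set C.T} {t : C.T} (ht : t ∈ P) : Meets t (region P) := by
  obtain ⟨p, hp, -⟩ := meets_univ t
  exact ⟨p, hp, t, ht, p, rfl⟩

/-- The five corners of every tile are distinct vertices. -/
def HasDistinctCorners (C : PentComplex) : Prop := ∀ t, Function.Injective (C.vert t)

/-! ### Paths and the path metric -/

theorem PathLength.nonneg {x y : C.Point} {l : ℝ} (h : PathLength x y l) : 0 ≤ l := by
  induction h with
  | refl x => exact le_rfl
  | step t p q y l h ih => exact add_nonneg dist_nonneg ih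

theorem PathLength.trans {x y z : C.Point} {l l' : ℝ} (h : PathLength x y l)
    (h' : PathLength y z l') : PathLength x z (l + l') := by
  induction h with
  | refl x => simpa using h'
  | step t p q y l h ih =>
    rw [add_assoc]
    exact PathLength.step t p q z _ (ih h')

theorem PathLength.single (t : C.T) (p q : pentagon) :
    PathLength (pt t p : C.Point) (pt t q) (dist p q) := by
  simpa using PathLength.step t p q _ 0 (PathLength.refl (pt t q : C.Point))

theorem PathLength.symm {x y : C.Point} {l : ℝ} (h : PathLength x y l) : PathLength y x l := by
  induction h with
  | refl x => exact PathLength.refl x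
  | step t p q y l h ih =>
    rw [add_comm, dist_comm]
    exact ih.trans (PathLength.single t q p)

theorem affDist_le {x y : C.Point} {l : ℝ} (h : PathLength x y l) : affDist x y ≤ l :=
  csInf_le ⟨0, fun _ h => PathLength.nonneg h⟩ h

theorem affDist_nonneg (x y : C.Point) : 0 ≤ affDist x y :=
  Real.sInf_nonneg fun _ h => PathLength.nonneg h

theorem affDist_self (x : C.Point) : affDist x x = 0 :=
  le_antisymm (affDist_le (PathLength.refl x)) (affDist_nonneg x x)

/-- Any two points are joined by a broken line. -/
def PathConnected (C : PentComplex) : Prop := ∀ x y : C.Point, ∃ l, PathLength x y l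

theorem PathConnected.exists_lt (hC : C.PathConnected) {x y : C.Point} {r : ℝ}
    (h : affDist x y < r) : ∃ l < r, PathLength x y l := by
  obtain ⟨l, hl, h⟩ := exists_lt_of_csInf_lt (hC x y) h
  exact ⟨l, h, hl⟩

theorem PathConnected.affDist_le_add (hC : C.PathConnected) {x y z : C.Point} {l : ℝ}
    (h : PathLength y z l) : affDist x z ≤ affDist x y + l := by
  refine le_of_forall_gt_imp_ge_of_dense fun r hr => ?_
  obtain ⟨l', hl', h'⟩ := hC.exists_lt (show affDist x y < r - l by linarith)
  linarith [affDist_le (h'.trans h)]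

/-- A function that is Lipschitz on every tile is Lipschitz for the path metric. -/
theorem PathConnected.sub_le_mul_affDist (hC : C.PathConnected) {f : C.Point → ℝ} {K : ℝ}
    (hK : 0 < K) (hf : ∀ t p q, f (pt t p) - f (pt t q) ≤ K * dist p q) (x y : C.Point) :
    f x - f y ≤ K * affDist x y := by
  have key : ∀ {x y : C.Point} {l : ℝ}, PathLength x y l → f x - f y ≤ K * l := by
    intro x y l h
    induction h with
    | refl x => simp
    | step t p q y l h ih => linarith [hf t p q]
  rw [← div_le_iff₀' hK]
  exact le_csInf (hC x y) fun l hl => by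
    rw [div_le_iff₀' hK]
    exact key hl

/-! #### Distinct vertices have distance at least one -/

/-- The function that is `1` at the vertex `u` and falls to `0` around it. -/
def hatAt (u : C.V) : C.Point → ℝ :=
  Quot.lift (fun a => (∑ k, Finsupp.single (C.vert a.1 k) (hat k a.2) : C.V →₀ ℝ) u) (by
    rintro a b ⟨c, ha, hb⟩
    simp only [← ha.eq_sum, ← hb.eq_sum])

theorem hatAt_pt_eq_sum (u : C.V) (t : C.T) (p : pentagon) :
    hatAt u (pt t p) = ∑ k, Finsupp.single (C.vert t k) (hat k p) u :=
  Finsupp.finsetSum_apply _ _ _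

theorem hatAt_vtx (u : C.V) (t : C.T) (i : Fin 5) :
    hatAt u (vtx t i) = Finsupp.single (C.vert t i) 1 u :=
  DFunLike.congr_fun (boundaryCoord_corner t i).eq_sum.symm u

/-- Since corners are distinct, at most one hat of a tile belongs to `u`, so no two slopes add up.
-/
theorem HasDistinctCorners.hatAt_sub_le (hC : C.HasDistinctCorners) (u : C.V) (t : C.T)
    (p q : pentagon) : hatAt u (pt t p) - hatAt u (pt t q) ≤ 1 * dist p q := by
  rw [hatAt_pt_eq_sum, hatAt_pt_eq_sum, one_mul]
  by_cases h : ∃ k, C.vert t k = u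
  · obtain ⟨k, rfl⟩ := h
    rw [Fintype.sum_eq_single k, Fintype.sum_eq_single k]
    · rw [Finsupp.single_eq_same, Finsupp.single_eq_same]
      exact hat_sub_le k p q
    all_goals
      intro j hj
      exact Finsupp.single_eq_of_ne fun h => hj (hC t h.symm)
  · push Not at h
    rw [Fintype.sum_eq_zero, Fintype.sum_eq_zero, sub_zero]
    · exact dist_nonneg
    all_goals
      intro j
      exact Finsupp.single_eq_of_ne (h j).symm

theorem eq_of_affDist_lt_one (hC : C.HasDistinctCorners) (hC' : C.PathConnected) {x y : C.Point}
    (hx : IsVertex x) (hy : IsVertex y) (h : affDist x y < 1) : x = y := by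
  obtain ⟨t, i, rfl⟩ := hx
  obtain ⟨t', j, rfl⟩ := hy
  have h1 := hC'.sub_le_mul_affDist one_pos (hC.hatAt_sub_le (C.vert t i)) (vtx t i) (vtx t' j)
  rw [hatAt_vtx, hatAt_vtx, Finsupp.single_eq_same, one_mul] at h1
  by_contra hne
  rw [vtx_eq_vtx_iff] at hne
  rw [Finsupp.single_eq_of_ne hne] at h1
  linarith

/-! #### Interior points of distinct tiles have positive distance -/

open Classical in
/-- The distance to the boundary on the tile `t`, extended by `0`. -/
def depth (t : C.T) : C.Point → ℝ :=
  Quot.lift (fun a => if a.1 = t then Metric.infDist (a.2 : ℂ) (interior pentagon)ᶜ else 0) (by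
    have h0 : ∀ {a : Σ _ : C.T, pentagon} {c}, C.BoundaryCoord a c →
        Metric.infDist (a.2 : ℂ) (interior pentagon)ᶜ = 0 :=
      fun ha => Metric.infDist_zero_of_mem ha.notMem_interior
    rintro a b ⟨c, ha, hb⟩
    simp only [h0 ha, h0 hb, ite_self])

theorem depth_sub_le (t s : C.T) (p q : pentagon) :
    depth t (pt s p) - depth t (pt s q) ≤ 1 * dist p q := by
  simp only [depth, pt]
  split_ifs
  · rw [one_mul, sub_le_iff_le_add, add_comm]
    exact Metric.infDist_le_infDist_add_dist
  · simp

/-- `depth t` is 1-Lipschitz, positive at interior points of `t` and zero on every other tile. -/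
theorem eq_of_affDist_eq_zero (hC : C.PathConnected) {t t' : C.T} {p q : pentagon}
    (hp : (p : ℂ) ∈ interior pentagon) (h : affDist (pt t p : C.Point) (pt t' q) = 0) :
    t = t' := by
  by_contra hne
  have h1 := hC.sub_le_mul_affDist one_pos (depth_sub_le t) (pt t p) (pt t' q)
  have h2 : depth t (pt t' q) = 0 := if_neg (Ne.symm hne)
  have h3 : depth t (pt t p) = Metric.infDist (p : ℂ) (interior pentagon)ᶜ := if_pos rfl
  have h4 : 0 < Metric.infDist (p : ℂ) (interior pentagon)ᶜ := by
    rw [← (isOpen_interior.isClosed_compl).notMem_iff_infDist_pos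
      ⟨corner 0, corner_notMem_interior 0⟩]
    simpa using hp
  rw [h, h2, h3] at h1
  linarith

/-! #### Edge distance and path metric -/

/-- A function on the vertices that changes by at most `1` along an edge. -/
def EdgeLipschitz (g : C.V → ℝ) : Prop :=
  ∀ t i, |g (C.vert t i) - g (C.vert t (i + 1))| ≤ 1

/-- At a boundary point the minimum defining the potential is attained at an end of the edge: going
on to a further corner lowers `g` by at most `1` per edge, and the factor `4` makes the extra
Euclidean distance (at least `1 / 4` for one edge) outweigh this. The vertex is taken in the support
because a point pasted at a single vertex need not share the edge. -/
theorem EdgeLipschitz.exists_mem_support_le (hC : C.HasDistinctCorners) {g : C.V → ℝ}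
    (hg : EdgeLipschitz g) {a : Σ _ : C.T, pentagon} {c : C.V →₀ ℝ} (h : C.BoundaryCoord a c)
    (k : Fin 5) : ∃ w ∈ c.support,
      g w + 4 * (1 - c w) ≤ g (C.vert a.1 k) + 4 * dist (a.2 : ℂ) (corner k) := by
  obtain ⟨i, s, h0, h1, hp, rfl⟩ := h
  change (a.2 : ℂ) = edgePt i s at hp
  have hne : i ≠ i + 1 := by clear hp; decide +revert
  have hv : C.vert a.1 i ≠ C.vert a.1 (i + 1) := fun h => hne (hC _ h)
  have e0 : (Finsupp.single (C.vert a.1 i) (1 - s) + Finsupp.single (C.vert a.1 (i + 1)) s)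
      (C.vert a.1 i) = 1 - s := by
    rw [Finsupp.add_apply, Finsupp.single_eq_same, Finsupp.single_eq_of_ne hv, add_zero]
  have e1 : (Finsupp.single (C.vert a.1 i) (1 - s) + Finsupp.single (C.vert a.1 (i + 1)) s)
      (C.vert a.1 (i + 1)) = s := by
    rw [Finsupp.add_apply, Finsupp.single_eq_same, Finsupp.single_eq_of_ne hv.symm, zero_add]
  suffices H : (s < 1 ∧ g (C.vert a.1 i) + 4 * s ≤
        g (C.vert a.1 k) + 4 * dist (a.2 : ℂ) (corner k)) ∨
      (0 < s ∧ g (C.vert a.1 (i + 1)) + 4 * (1 - s) ≤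
        g (C.vert a.1 k) + 4 * dist (a.2 : ℂ) (corner k)) by
    rcases H with ⟨hs, H⟩ | ⟨hs, H⟩
    · refine ⟨C.vert a.1 i, ?_, ?_⟩
      · rw [Finsupp.mem_support_iff, e0]
        linarith
      · rw [e0]
        linarith
    · refine ⟨C.vert a.1 (i + 1), ?_, ?_⟩
      · rw [Finsupp.mem_support_iff, e1]
        linarith
      · rw [e1]
        linarith
  have g0 := abs_le.1 (hg a.1 i)
  have g1 := abs_le.1 (hg a.1 (i + 1))
  have g2 := abs_le.1 (hg a.1 (i + 2))
  have g3 := abs_le.1 (hg a.1 (i + 3))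
  have g4 := abs_le.1 (hg a.1 (i + 4))
  rw [(by clear * - ; decide +revert : i + 1 + 1 = i + 2)] at g1
  rw [(by clear * - ; decide +revert : i + 2 + 1 = i + 3)] at g2
  rw [(by clear * - ; decide +revert : i + 3 + 1 = i + 4)] at g3
  rw [(by clear * - ; decide +revert : i + 4 + 1 = i)] at g4
  rw [hp]
  rcases fin_five_cases i k with rfl | rfl | rfl | rfl | rfl
  · rw [dist_edgePt_left h0]
    rcases h1.lt_or_eq with hs | hs
    · exact Or.inl ⟨hs, le_rfl⟩
    · exact Or.inr ⟨by linarith, by linarith⟩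
  · rw [dist_edgePt_right h1]
    rcases h0.lt_or_eq with hs | hs
    · exact Or.inr ⟨hs, le_rfl⟩
    · exact Or.inl ⟨by linarith, by linarith⟩
  · have hd := (le_dist_edgePt_add_two (j := i) h1).1
    rcases h0.lt_or_eq with hs | hs
    · exact Or.inr ⟨hs, by linarith⟩
    · exact Or.inl ⟨by linarith, by linarith⟩
  · have hd := le_dist_edgePt_add_three i s
    rcases le_total s (1 / 2) with hs | hs
    · exact Or.inl ⟨by linarith, by linarith⟩
    · exact Or.inr ⟨by linarith, by linarith⟩
  · have hd := (le_dist_edgePt_add_four (j := i) h0).1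
    rcases h1.lt_or_eq with hs | hs
    · exact Or.inl ⟨hs, by linarith⟩
    · exact Or.inr ⟨by linarith, by linarith⟩

/-- The distance to a supporting vertex is read off from `c` alone, hence is the same in all tiles
pasted at this point. -/
theorem BoundaryCoord.exists_one_sub_eq_dist (hC : C.HasDistinctCorners)
    {a : Σ _ : C.T, pentagon} {c : C.V →₀ ℝ} (h : C.BoundaryCoord a c) {w : C.V}
    (hw : w ∈ c.support) : ∃ k, C.vert a.1 k = w ∧ 1 - c w = dist (a.2 : ℂ) (corner k) := by
  obtain ⟨k, rfl⟩ := h.exists_vert_of_mem_support hw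
  refine ⟨k, rfl, ?_⟩
  have h1 : c (C.vert a.1 k) = hat k a.2 := by
    conv_lhs => rw [h.eq_sum]
    rw [Finsupp.finsetSum_apply, Fintype.sum_eq_single k, Finsupp.single_eq_same]
    intro j hj
    exact Finsupp.single_eq_of_ne fun h => hj (hC _ h.symm)
  rw [Finsupp.mem_support_iff, h1] at hw
  rw [h1]
  unfold hat at hw ⊢
  rcases max_choice 0 (1 - dist (a.2 : ℂ) (corner k)) with h | h
  · exact absurd h hw
  · rw [h]
    ring

/-- The infimal convolution, on every tile, of a function on the vertices and four times the
Euclidean distance. -/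
def tilePotential (g : C.V → ℝ) (a : Σ _ : C.T, pentagon) : ℝ :=
  Finset.univ.inf' Finset.univ_nonempty
    fun k => g (C.vert a.1 k) + 4 * dist (a.2 : ℂ) (corner k)

theorem tilePotential_le (g : C.V → ℝ) (a : Σ _ : C.T, pentagon) (k : Fin 5) :
    tilePotential g a ≤ g (C.vert a.1 k) + 4 * dist (a.2 : ℂ) (corner k) :=
  Finset.inf'_le _ (Finset.mem_univ k)

theorem exists_tilePotential_eq (g : C.V → ℝ) (a : Σ _ : C.T, pentagon) :
    ∃ k, tilePotential g a = g (C.vert a.1 k) + 4 * dist (a.2 : ℂ) (corner k) := by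
  obtain ⟨k, -, h⟩ := Finset.exists_mem_eq_inf' (Finset.univ_nonempty (α := Fin 5))
    fun k => g (C.vert a.1 k) + 4 * dist (a.2 : ℂ) (corner k)
  exact ⟨k, h⟩

theorem EdgeLipschitz.tilePotential_eq_of_glue (hC : C.HasDistinctCorners) {g : C.V → ℝ}
    (hg : EdgeLipschitz g) {a b : Σ _ : C.T, pentagon} (h : C.Glue a b) :
    tilePotential g a = tilePotential g b := by
  have key : ∀ {a b : Σ _ : C.T, pentagon} {c}, C.BoundaryCoord a c → C.BoundaryCoord b c →
      tilePotential g a ≤ tilePotential g b := by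
    intro a b c ha hb
    obtain ⟨k, hk⟩ := exists_tilePotential_eq g b
    obtain ⟨w, hw, hle⟩ := hg.exists_mem_support_le hC hb k
    obtain ⟨j, rfl, hd⟩ := ha.exists_one_sub_eq_dist hC hw
    rw [hd] at hle
    rw [hk]
    exact (tilePotential_le g a j).trans hle
  obtain ⟨c, ha, hb⟩ := h
  exact le_antisymm (key ha hb) (key hb ha)

theorem tilePotential_sub_le (g : C.V → ℝ) (t : C.T) (p q : pentagon) :
    tilePotential g ⟨t, p⟩ - tilePotential g ⟨t, q⟩ ≤ 4 * dist p q := by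
  obtain ⟨k, hk⟩ := exists_tilePotential_eq g ⟨t, q⟩
  have h1 := tilePotential_le g ⟨t, p⟩ k
  have h2 : dist (p : ℂ) (corner k) ≤ dist p q + dist (q : ℂ) (corner k) :=
    dist_triangle _ _ _
  simp only at hk h1
  linarith

/-- A function that changes by at most `1` along an edge is `4`-Lipschitz for the path metric. -/
theorem EdgeLipschitz.exists_le (hC : C.HasDistinctCorners) (hC' : C.PathConnected)
    {g : C.V → ℝ} (hg : EdgeLipschitz g) (t t' : C.T) (i : Fin 5) (p : pentagon) :
    ∃ k, g (C.vert t' k) ≤ g (C.vert t i) + 4 * affDist (vtx t i : C.Point) (pt t' p) := by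
  -- The potential is at most `g` at the starting vertex, and at the end point it is at least `g` of
  -- the minimizing corner `k`.
  let f : C.Point → ℝ := Quot.lift (fun a => -tilePotential g a)
    fun a b h => congrArg Neg.neg (hg.tilePotential_eq_of_glue hC h)
  have h1 := hC'.sub_le_mul_affDist (f := f) (K := 4) (by norm_num)
    (fun t p q => by
      change -tilePotential g ⟨t, p⟩ - -tilePotential g ⟨t, q⟩ ≤ _
      have := tilePotential_sub_le g t q p
      rw [dist_comm q p] at this
      linarith) (vtx t i) (pt t' p)
  change -tilePotential g ⟨t, cornerPt i⟩ - -tilePotential g ⟨t', p⟩ ≤ _ at h1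
  have h2 := tilePotential_le g ⟨t, cornerPt i⟩ i
  change _ ≤ _ + 4 * dist (corner i) (corner i) at h2
  rw [dist_self] at h2
  obtain ⟨k, hk⟩ := exists_tilePotential_eq g ⟨t', p⟩
  refine ⟨k, ?_⟩
  have h3 := dist_nonneg (x := (p : ℂ)) (y := corner k)
  simp only at hk h2
  linarith

/-! #### The one-skeleton -/

theorem HasDistinctCorners.adj (hC : C.HasDistinctCorners) (t : C.T) (i : Fin 5) :
    C.skeleton.Adj (vtx t i) (vtx t (i + 1)) := by
  refine ⟨fun h => ?_, Or.inl ⟨t, i, rfl, rfl⟩⟩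
  have := hC t (vtx_eq_vtx_iff.1 h)
  clear h
  revert this
  decide +revert

theorem HasDistinctCorners.exists_walk (hC : C.HasDistinctCorners) (t : C.T) (i k : Fin 5) :
    ∃ w : C.skeleton.Walk (vtx t i) (vtx t k), w.length ≤ 2 := by
  have h1 : ∀ i : Fin 5, ∃ w : C.skeleton.Walk (vtx t i) (vtx t (i + 1)), w.length = 1 :=
    fun i => ⟨(hC.adj t i).toWalk, rfl⟩
  have h2 : ∀ i : Fin 5, ∃ w : C.skeleton.Walk (vtx t i) (vtx t (i + 1 + 1)), w.length = 2 := by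
    intro i
    obtain ⟨w, hw⟩ := h1 i
    obtain ⟨w', hw'⟩ := h1 (i + 1)
    exact ⟨w.append w', by rw [SimpleGraph.Walk.length_append, hw, hw']⟩
  have hk : k = i ∨ k = i + 1 ∨ k = i + 1 + 1 ∨ i = k + 1 + 1 ∨ i = k + 1 := by
    decide +revert
  rcases hk with rfl | rfl | rfl | rfl | rfl
  · exact ⟨SimpleGraph.Walk.nil, by simp⟩
  · obtain ⟨w, hw⟩ := h1 i
    exact ⟨w, by omega⟩
  · obtain ⟨w, hw⟩ := h2 i
    exact ⟨w, hw.le⟩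
  · obtain ⟨w, hw⟩ := h2 k
    exact ⟨w.reverse, by rw [SimpleGraph.Walk.length_reverse, hw]⟩
  · obtain ⟨w, hw⟩ := h1 k
    exact ⟨w.reverse, by rw [SimpleGraph.Walk.length_reverse, hw]; omega⟩

theorem WithinEdgeDist.tile (hC : C.HasDistinctCorners) {x : C.Point} {t : C.T} {i : Fin 5}
    {r : ℝ} (h : WithinEdgeDist x (vtx t i) r) (k : Fin 5) :
    WithinEdgeDist x (vtx t k) (r + 2) := by
  obtain ⟨w, hw⟩ := h
  obtain ⟨w', hw'⟩ := hC.exists_walk t i k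
  refine ⟨w.append w', ?_⟩
  rw [SimpleGraph.Walk.length_append, Nat.cast_add]
  have : (w'.length : ℝ) ≤ 2 := by exact_mod_cast hw'
  linarith

theorem PathLength.of_walk {x y : C.Point} (w : C.skeleton.Walk x y) :
    PathLength x y w.length := by
  induction w with
  | nil => simpa using PathLength.refl _
  | cons h w ih =>
    have h1 : ∀ t : C.T, ∀ i, PathLength (vtx t i : C.Point) (vtx t (i + 1)) 1 := by
      intro t i
      have := PathLength.single t (cornerPt i) (cornerPt (i + 1))
      rwa [Subtype.dist_eq, cornerPt, cornerPt, dist_corner_succ] at this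
    rw [SimpleGraph.Walk.length_cons, Nat.cast_add, Nat.cast_one, add_comm]
    refine PathLength.trans ?_ ih
    rcases h.2 with ⟨t, i, rfl, rfl⟩ | ⟨t, i, rfl, rfl⟩
    · exact h1 t i
    · exact (h1 t i).symm

theorem WithinEdgeDist.affDist_le {x y : C.Point} {r : ℝ} (h : WithinEdgeDist x y r) :
    affDist x y ≤ r := by
  obtain ⟨w, hw⟩ := h
  exact (PentComplex.affDist_le (PathLength.of_walk w)).trans hw

/-- The preimage of `U` in each pentagon is everything or nothing. -/
theorem isClopen_of_tiles {R : Set C.T} {U : Set C.Point}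
    (h : ∀ t p, (pt t p : C.Point) ∈ U ↔ t ∈ R) : IsClopen U := by
  have key : ∀ {R : Set C.T} {U : Set C.Point}, (∀ t p, (pt t p : C.Point) ∈ U ↔ t ∈ R) →
      IsOpen U := by
    intro R U h
    refine isOpen_coinduced.2 (isOpen_sigma_iff.2 fun t => ?_)
    by_cases ht : t ∈ R
    · convert isOpen_univ
      exact eq_univ_of_forall fun p => (h t p).2 ht
    · convert isOpen_empty
      exact eq_empty_of_forall_notMem fun p hp => ht ((h t p).1 hp)
  refine ⟨⟨key (R := Rᶜ) fun t p => ?_⟩, key h⟩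
  rw [mem_compl_iff, mem_compl_iff, h]

/-- The one-skeleton of a connected complex is connected. -/
theorem HasDistinctCorners.reachable (hC : C.HasDistinctCorners) [PreconnectedSpace C.Point]
    (t t' : C.T) (i j : Fin 5) : C.skeleton.Reachable (vtx t i) (vtx t' j) := by
  have hr : ∀ t i j, C.skeleton.Reachable (vtx t i) (vtx t j) := fun t i j =>
    ⟨(hC.exists_walk t i j).choose⟩
  -- Tiles that meet share a vertex, so `U` is a union of tiles that no other tile meets. It is
  -- clopen and hence everything.
  let U : Set C.Point := {x | ∃ s p, C.skeleton.Reachable (vtx t i) (vtx s 0) ∧ pt s p = x}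
  have hU : IsClopen U := by
    refine isClopen_of_tiles (R := {s | C.skeleton.Reachable (vtx t i) (vtx s 0)})
      fun s p => ⟨?_, fun h => ⟨s, p, h, rfl⟩⟩
    rintro ⟨s', p', h, heq⟩
    rcases eq_or_exists_vtx_eq heq with rfl | ⟨a, b, hab⟩
    · exact h
    · refine (h.trans (hr s' 0 a)).trans ?_
      rw [hab]
      exact hr s b 0
  have hU' := hU.eq_univ ⟨vtx t i, t, cornerPt i, hr t i 0, rfl⟩
  obtain ⟨s', p', h, heq⟩ : (vtx t' j : C.Point) ∈ U := hU' ▸ mem_univ _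
  rcases eq_or_exists_vtx_eq heq with rfl | ⟨a, b, hab⟩
  · exact h.trans (hr _ 0 j)
  · refine (h.trans (hr s' 0 a)).trans ?_
    rw [hab]
    exact hr t' b j

theorem HasDistinctCorners.pathConnected (hC : C.HasDistinctCorners)
    [PreconnectedSpace C.Point] : C.PathConnected := by
  intro x y
  obtain ⟨t, p, rfl⟩ := exists_pt x
  obtain ⟨t', q, rfl⟩ := exists_pt y
  obtain ⟨w⟩ := hC.reachable t t' 0 0
  exact ⟨_, ((PathLength.single t p (cornerPt 0)).trans (PathLength.of_walk w)).trans
    (PathLength.single t' (cornerPt 0) q)⟩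

/-- Edge distance is bounded by path distance. -/
theorem HasDistinctCorners.withinEdgeDist (hC : C.HasDistinctCorners)
    [PreconnectedSpace C.Point] {v : C.Point} (hv : IsVertex v) (t : C.T) (p : pentagon)
    (k : Fin 5) : WithinEdgeDist v (vtx t k) (4 * affDist v (pt t p) + 2) := by
  classical
  obtain ⟨t₀, i₀, rfl⟩ := hv
  -- Graph distance from the base vertex; the value `0` is used only at elements of `C.V` that are
  -- corners of no tile.
  let g : C.V → ℝ := fun u => if h : ∃ a : C.T × Fin 5, C.vert a.1 a.2 = u then
    C.skeleton.dist (vtx t₀ i₀) (vtx h.choose.1 h.choose.2) else 0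
  have hg : ∀ t i, g (C.vert t i) = C.skeleton.dist (vtx t₀ i₀) (vtx t i) := by
    intro t i
    have h : ∃ a : C.T × Fin 5, C.vert a.1 a.2 = C.vert t i := ⟨(t, i), rfl⟩
    simp only [g, dif_pos h]
    rw [vtx_eq_vtx_iff.2 h.choose_spec]
  have hle : ∀ {t t' : C.T} {i j : Fin 5}, C.skeleton.Adj (vtx t i) (vtx t' j) →
      g (C.vert t' j) ≤ g (C.vert t i) + 1 := by
    intro t t' i j h
    obtain ⟨w, hw⟩ := (hC.reachable t₀ t i₀ i).exists_walk_length_eq_dist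
    rw [hg, hg, ← hw]
    have := SimpleGraph.dist_le (w.concat h)
    rw [SimpleGraph.Walk.length_concat] at this
    exact_mod_cast this
  have hL : EdgeLipschitz g := by
    intro t i
    have h1 := hle (hC.adj t i)
    have h2 := hle (hC.adj t i).symm
    rw [abs_le]
    constructor <;> linarith
  obtain ⟨j, hj⟩ := hL.exists_le hC hC.pathConnected t₀ t i₀ p
  rw [hg, hg, SimpleGraph.dist_self, Nat.cast_zero, zero_add] at hj
  obtain ⟨w, hw⟩ := (hC.reachable t₀ t i₀ j).exists_walk_length_eq_dist
  exact WithinEdgeDist.tile hC ⟨w, by rw [hw]; exact hj⟩ k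

/-! #### Local finiteness -/

theorem continuous_pt (t : C.T) : Continuous (pt t : pentagon → C.Point) :=
  continuous_coinduced_rng.comp (continuous_sigmaMk (σ := fun _ : C.T => pentagon))

theorem vtx_ne_pt_of_mem_interior {t t' : C.T} {i : Fin 5} {p : pentagon}
    (hp : (p : ℂ) ∈ interior pentagon) : (vtx t i : C.Point) ≠ pt t' p := by
  intro h
  have h1 := (eq_of_pt_eq_of_mem_interior hp h.symm).2
  rw [h1] at hp
  exact corner_notMem_interior i hp

/-- A first countable complex has finite degrees. -/
theorem finite_tiles_of_firstCountable [FirstCountableTopology C.Point] (u : C.Point) :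
    {t : C.T | ∃ i : Fin 5, vtx t i = u}.Finite := by
  by_contra hinf
  let e := Set.Infinite.natEmbedding _ hinf
  obtain ⟨U, hU⟩ := (nhds u).exists_antitone_basis
  have h1 : ∀ n, ∃ p : pentagon, (p : ℂ) ∈ interior pentagon ∧
      (pt (e n : C.T) p : C.Point) ∈ U n := by
    intro n
    obtain ⟨i, hi⟩ := (e n).2
    have h2 : (pt (e n : C.T) : pentagon → C.Point) ⁻¹' U n ∈ nhds (cornerPt i) := by
      refine (continuous_pt _).continuousAt ?_
      change U n ∈ nhds (vtx (e n : C.T) i)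
      rw [hi]
      exact hU.mem n
    obtain ⟨δ, hδ, hball⟩ := Metric.mem_nhds_iff.1 h2
    obtain ⟨p, hp, hd⟩ := exists_interior_near_corner i hδ
    exact ⟨p, hp, hball hd⟩
  choose p hp hpU using h1
  have hlim := hU.tendsto hpU
  -- The sequence converges to `u`, but its range meets every tile in at most one point, so it is
  -- closed, and it misses `u`.
  let X : Set C.Point := range fun n => pt (e n : C.T) (p n)
  have hX : IsClosed X := by
    refine isClosed_coinduced.2 (isClosed_sigma_iff.2 fun t => ?_)
    refine Set.Subsingleton.isClosed ?_
    rintro q ⟨n, hn⟩ q' ⟨m, hm⟩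
    obtain ⟨h1, rfl⟩ := eq_of_pt_eq_of_mem_interior (hp n) hn
    obtain ⟨h2, rfl⟩ := eq_of_pt_eq_of_mem_interior (hp m) hm
    rw [e.injective (Subtype.ext (h1.trans h2.symm))]
  have hu : u ∉ X := by
    rintro ⟨n, hn⟩
    obtain ⟨i, hi⟩ := (e n).2
    exact vtx_ne_pt_of_mem_interior (hp n) (hi.trans hn.symm)
  obtain ⟨n, hn⟩ := (hlim.eventually (hX.isOpen_compl.mem_nhds hu)).exists
  exact hn ⟨n, rfl⟩

end PentComplex

/-! ### The tiles of `K` and of locally isomorphic tilings have distinct corners -/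

/-- In a corner tile only the two edge midpoints and the two inner vertices could coincide; the
midpoints differ because the two neighbouring old corners do. -/
theorem HasDistinctCorners.subdivide {C : PentComplex} (hC : C.HasDistinctCorners) :
    (subdivide C).HasDistinctCorners := by
  rintro ⟨t, _ | k⟩ i j h
  · simpa [PentHull.subdivide] using h
  · have h1 : C.vert t (k + 1) ≠ C.vert t (k - 1) := fun h =>
      (by decide : ∀ k : Fin 5, k + 1 ≠ k - 1) k (hC t h)
    have h3 : C.vert t k ≠ C.vert t (k - 1) := fun h =>
      (by decide : ∀ k : Fin 5, k ≠ k - 1) k (hC t h)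
    have h2 : k ≠ k - 1 := (by decide : ∀ k : Fin 5, k ≠ k - 1) k
    fin_cases i <;> fin_cases j <;>
      simp_all [PentHull.subdivide, eq_comm]

theorem Kn_hasDistinctCorners : ∀ n, (Kn n).HasDistinctCorners
  | 0 => fun _ _ _ h => h
  | n + 1 => HasDistinctCorners.subdivide (Kn_hasDistinctCorners n)

theorem incl_injective :
    ∀ n, Function.Injective (incl n).onV ∧ Function.Injective (incl n).onT
  | 0 => by
    refine ⟨fun i j h => ?_, fun _ _ _ => rfl⟩
    exact congrArg Prod.snd (Sum.inr_injective (Sum.inr_injective h))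
  | n + 1 => by
    obtain ⟨hV, hT⟩ := incl_injective n
    have hT' := hT.prodMap (Function.injective_id (α := Fin 5))
    exact ⟨hV.sumMap ((Sym2.map.injective hV).sumMap hT'),
      hT.prodMap (Function.injective_id (α := Option (Fin 5)))⟩

/-- Two elements have the same image in the direct limit along `f` when they have a common
iterated image. -/
theorem exists_iterate_eq_of_quot_eq {α : Type*} (f : α → α) {a b : α}
    (h : Quot.mk (fun a b => b = f a) a = Quot.mk (fun a b => b = f a) b) :
    ∃ k l : ℕ, f^[k] a = f^[l] b := by
  have h' := Quot.eqvGen_exact h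
  clear h
  induction h' with
  | rel a b h => exact ⟨1, 0, h.symm⟩
  | refl a => exact ⟨0, 0, rfl⟩
  | symm a b _ ih =>
    obtain ⟨k, l, h⟩ := ih
    exact ⟨l, k, h.symm⟩
  | trans a b c _ _ ih ih' =>
    obtain ⟨k, l, h⟩ := ih
    obtain ⟨k', l', h'⟩ := ih'
    refine ⟨k' + k, l + l', ?_⟩
    rw [Function.iterate_add_apply, h, ← Function.iterate_add_apply, add_comm k' l,
      Function.iterate_add_apply, h', ← Function.iterate_add_apply]

theorem K_hasDistinctCorners : K.HasDistinctCorners := by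
  intro t i j h
  obtain ⟨⟨n, t⟩, rfl⟩ := Quot.exists_rep t
  let f : (Σ n, (Kn n).V) → (Σ n, (Kn n).V) := fun a => ⟨a.1 + 1, (incl a.1).onV a.2⟩
  -- The transition map is injective and raises the level by one, so elements of one level that
  -- agree in the limit have a common image after equally many steps and are equal.
  have hf : Function.Injective f := by
    rintro ⟨n, x⟩ ⟨m, y⟩ h
    have hnm : n = m := Nat.succ_injective (congrArg Sigma.fst h)
    subst hnm
    have h2 : (incl n).onV x = (incl n).onV y := eq_of_heq (Sigma.mk.inj_iff.1 h).2
    rw [(incl_injective n).1 h2]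
  have hfst : ∀ (k : ℕ) (a : Σ n, (Kn n).V), (f^[k] a).1 = a.1 + k := by
    intro k
    induction k with
    | zero => exact fun a => rfl
    | succ k ih =>
      intro a
      rw [Function.iterate_succ_apply, ih]
      simp only [f]
      omega
  obtain ⟨k, l, hkl⟩ := exists_iterate_eq_of_quot_eq f
    (a := ⟨n, (Kn n).vert t i⟩) (b := ⟨n, (Kn n).vert t j⟩) h
  have h1 := hfst k ⟨n, (Kn n).vert t i⟩
  rw [hkl, hfst] at h1
  have hlk : l = k := by simpa using h1
  subst hlk
  have h2 := hf.iterate l hkl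
  exact Kn_hasDistinctCorners n t (eq_of_heq (Sigma.mk.inj_iff.1 h2).2)

theorem perm_injective (A : PentSym) : Function.Injective (perm A) := by
  intro i j h
  have h1 : (A : ℂ ≃ₗᵢ[ℝ] ℂ) (corner i) = (A : ℂ ≃ₗᵢ[ℝ] ℂ) (corner j) := by
    rw [apply_corner, apply_corner, h]
  exact corner_injective ((A : ℂ ≃ₗᵢ[ℝ] ℂ).injective h1)

theorem pt_act_cornerPt {C : PentComplex} (t : C.T) (A : PentSym) (i : Fin 5) :
    (pt t (act A (cornerPt i)) : C.Point) = vtx t (perm A i) := by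
  rw [act_cornerPt, vtx]

variable {D : Type*} [MulAction PentSym D]

theorem LocallyIsomorphic.hasDistinctCorners {L M : DecComplex D} (h : LocallyIsomorphic L M)
    (hM : M.HasDistinctCorners) : L.HasDistinctCorners := by
  intro t i j hij
  obtain ⟨φ, -, hφ⟩ := h {t} (finite_singleton t)
  obtain ⟨t', A, -, hφ⟩ := hφ t (meets_region rfl)
  have h1 : ∀ k, φ (vtx t k) = vtx t' (perm A k) := by
    intro k
    rw [← pt_act_cornerPt]
    exact hφ _ ⟨t, rfl, _, rfl⟩
  have h2 := congrArg φ (vtx_eq_vtx_iff.2 hij)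
  rw [h1, h1, vtx_eq_vtx_iff] at h2
  exact perm_injective A (hM t' h2)

/-! ### Pointed tilings: connectedness, countability and base vertices. -/

variable {κ : K.T → D}

theorem PointedTiling.hasDistinctCorners (a : PointedTiling κ) : a.L.HasDistinctCorners :=
  LocallyIsomorphic.hasDistinctCorners a.locallyIsomorphic K_hasDistinctCorners

instance (a : PointedTiling κ) : PreconnectedSpace a.L.Point := by
  obtain ⟨e⟩ := a.plane
  refine ⟨?_⟩
  rw [← e.symm.range_coe]
  exact isPreconnected_range e.symm.continuous

instance (a : PointedTiling κ) : FirstCountableTopology a.L.Point := by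
  obtain ⟨e⟩ := a.plane
  exact e.isInducing.firstCountableTopology

theorem PointedTiling.pathConnected (a : PointedTiling κ) : a.L.PathConnected :=
  a.hasDistinctCorners.pathConnected

/-- The metrics range over all representatives of a class, while `Xi` provides only one that is
pointed at a vertex. -/
theorem isVertex_of_cls_eq {a b : PointedTiling κ} (hb : IsVertex b.x) (h : cls b = cls a) :
    IsVertex a.x := by
  obtain ⟨φ, hφ, -, hx⟩ : PointedTiling.Iso b a := Quotient.exact h
  obtain ⟨t, i, hi⟩ := hb
  obtain ⟨t', A, -, hφ⟩ := hφ t (meets_univ t)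
  refine ⟨t', perm A i, ?_⟩
  rw [← hx, ← hi, ← pt_act_cornerPt]
  exact (hφ _ (mem_univ _)).symm

theorem isVertex_of_mem_Xi {a : PointedTiling κ} (h : cls a ∈ Xi κ) : IsVertex a.x := by
  obtain ⟨b, hb, h⟩ := h
  exact isVertex_of_cls_eq hb h

/-! ### Maps that are given tile by tile -/

section TileMaps

variable {C C' : PentComplex} {φ : C.Point → C'.Point} {P : Set C.T} {v : C.Point} {ρ : ℝ}

/-- On every tile of `P` the map `φ` is an isometry onto a tile. -/
def IsTileMapOn (φ : C.Point → C'.Point) (P : Set C.T) : Prop :=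
  ∀ t ∈ P, ∃ t', ∃ A : PentSym, ∀ p, φ (pt t p) = pt t' (act A p)

/-- A path too short to leave the ball of radius `ρ` runs in tiles of `P`, where `φ` keeps the
length of each segment. -/
theorem IsTileMapOn.pathLength (hφ : IsTileMapOn φ P) (hC : C.PathConnected)
    (hP : ∀ t p, affDist v (pt t p) ≤ ρ → t ∈ P) {y z : C.Point} {l : ℝ}
    (h : PathLength y z l) (hl : affDist v y + l ≤ ρ) : PathLength (φ y) (φ z) l := by
  induction h with
  | refl y => exact PathLength.refl _
  | step t p q z l h ih =>
    have h0 := h.nonneg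
    have h1 := hC.affDist_le_add (x := v) (PathLength.single t p q)
    obtain ⟨t', A, hA⟩ := hφ t (hP t p (by linarith [dist_nonneg (x := p) (y := q)]))
    rw [hA, ← dist_act A p q]
    refine PathLength.step t' _ _ _ _ ?_
    rw [← hA]
    exact ih (by linarith)

/-- A degree preserving injective tile map is surjective around a vertex. -/
theorem IsTileMapOn.exists_tile_of_vtx_eq (hφ : IsTileMapOn φ P) (hinj : InjOn φ (region P))
    {u : C.Point} (hu : {t : C.T | ∃ i : Fin 5, vtx t i = u} ⊆ P)
    (hfin : {t : C.T | ∃ i : Fin 5, vtx t i = u}.Finite) (hdeg : degree (φ u) = degree u)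
    {t' : C'.T} {j : Fin 5} (ht' : vtx t' j = φ u) :
    ∃ t ∈ P, ∃ A : PentSym, ∀ p, φ (pt t p) = pt t' (act A p) := by
  classical
  have hne : Nonempty C'.T := ⟨t'⟩
  choose! τ A hτ using hφ
  have hsub : τ '' {t : C.T | ∃ i : Fin 5, vtx t i = u} ⊆
      {t : C'.T | ∃ i : Fin 5, vtx t i = φ u} := by
    rintro _ ⟨t, ht, rfl⟩
    have htP := hu ht
    obtain ⟨i, rfl⟩ := ht
    exact ⟨perm (A t) i, by rw [← pt_act_cornerPt]; exact (hτ t htP _).symm⟩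
  have hinj' : InjOn τ {t : C.T | ∃ i : Fin 5, vtx t i = u} := by
    intro t ht s hs hts
    obtain ⟨p, hp, -⟩ := meets_univ t
    have h1 := hτ t (hu ht) p
    have h2 := hτ s (hu hs) (act (A s)⁻¹ (act (A t) p))
    rw [act_act_inv, ← hts, ← h1] at h2
    exact (eq_of_pt_eq_of_mem_interior hp
      (hinj ⟨s, hu hs, _, rfl⟩ ⟨t, hu ht, _, rfl⟩ h2).symm).1
  have hcard : {t : C'.T | ∃ i : Fin 5, vtx t i = φ u}.encard =
      (τ '' {t : C.T | ∃ i : Fin 5, vtx t i = u}).encard := by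
    rw [hinj'.encard_image]
    exact hdeg
  -- Without finiteness, equal degrees would not make the image the full star.
  have heq := (hfin.image τ).eq_of_subset_of_encard_le hsub hcard.le
  obtain ⟨t, ht, rfl⟩ : t' ∈ τ '' {t : C.T | ∃ i : Fin 5, vtx t i = u} := by
    rw [heq]
    exact ⟨j, ht'⟩
  exact ⟨t, hu ht, A t, hτ t (hu ht)⟩

/-- The tile `t'` is the image of `s` or shares with it the image of a corner of `s`. The star of
that corner maps onto the star of its image, so `t'` is the image of a tile; injectivity identifies
the lifted point. -/
theorem IsTileMapOn.exists_lift (hφ : IsTileMapOn φ P) (hinj : InjOn φ (region P))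
    (hfin : ∀ u : C.Point, {t : C.T | ∃ i : Fin 5, vtx t i = u}.Finite)
    (hdeg : ∀ u ∈ region P, IsVertex u → degree (φ u) = degree u)
    {s : C.T} (hs : s ∈ P) (hstar : ∀ t i k, (vtx t i : C.Point) = vtx s k → t ∈ P)
    {q : pentagon} {t' : C'.T} {p : pentagon} (h : φ (pt s q) = pt t' p) :
    ∃ t ∈ P, ∃ A : PentSym, pt t (act A⁻¹ p) = (pt s q : C.Point) ∧
      ∀ p, φ (pt t p) = pt t' (act A p) := by
  obtain ⟨s', B, hB⟩ := hφ s hs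
  have key : ∃ t ∈ P, ∃ A : PentSym, ∀ p, φ (pt t p) = pt t' (act A p) := by
    have h' := h
    rw [hB] at h'
    rcases eq_or_exists_vtx_eq h' with rfl | ⟨i, j, hij⟩
    · exact ⟨s, hs, B, hB⟩
    · have hu : φ (vtx s (perm B⁻¹ i)) = vtx s' i := by
        rw [vtx, hB, pt_act_cornerPt, perm_perm_inv]
      refine hφ.exists_tile_of_vtx_eq hinj (u := vtx s (perm B⁻¹ i)) ?_ (hfin _) ?_
        (hij.symm.trans hu.symm)
      · rintro t ⟨k, hk⟩
        exact hstar t k _ hk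
      · exact hdeg _ ⟨s, hs, _, rfl⟩ ⟨s, _, rfl⟩
  obtain ⟨t, ht, A, hA⟩ := key
  refine ⟨t, ht, A, hinj ⟨t, ht, _, rfl⟩ ⟨s, hs, _, rfl⟩ ?_, hA⟩
  rw [hA, act_act_inv, h]

/-- Paths can be lifted along a degree preserving injective tile map. -/
theorem IsTileMapOn.exists_pathLength (hφ : IsTileMapOn φ P) (hinj : InjOn φ (region P))
    (hfin : ∀ u : C.Point, {t : C.T | ∃ i : Fin 5, vtx t i = u}.Finite)
    (hdeg : ∀ u ∈ region P, IsVertex u → degree (φ u) = degree u) (hC : C.PathConnected)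
    (hP : ∀ t p, affDist v (pt t p) ≤ ρ → t ∈ P)
    (hstar : ∀ s p, affDist v (pt s p) ≤ ρ → ∀ t i k, (vtx t i : C.Point) = vtx s k → t ∈ P)
    {x' z' : C'.Point} {l : ℝ} (h : PathLength x' z' l) :
    ∀ y : C.Point, φ y = x' → affDist v y + l ≤ ρ → ∃ z, PathLength y z l ∧ φ z = z' := by
  induction h with
  | refl x => exact fun y hy _ => ⟨y, PathLength.refl y, hy⟩
  | step t' p q z' l h ih =>
    intro y hy hl
    have h0 := h.nonneg
    obtain ⟨s, r, rfl⟩ := exists_pt y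
    have hle : affDist v (pt s r) ≤ ρ := by linarith [dist_nonneg (x := p) (y := q)]
    obtain ⟨t, ht, A, hA, hA'⟩ :=
      hφ.exists_lift hinj hfin hdeg (hP s r hle) (hstar s r hle) hy
    have h1 := PathLength.single t (act A⁻¹ p) (act A⁻¹ q)
    rw [hA, dist_act] at h1
    obtain ⟨z, hz, hz'⟩ := ih (pt t (act A⁻¹ q)) (by rw [hA', act_act_inv])
      (by linarith [hC.affDist_le_add (x := v) h1])
    exact ⟨z, h1.trans hz, hz'⟩

end TileMaps

theorem isTileMapOn_of_isCellMapOn {L M : DecComplex D} {φ : L.Point → M.Point} {P : Set L.T}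
    {S : Set L.Point} (h : IsCellMapOn φ S) (hS : region P ⊆ S) : IsTileMapOn φ P := by
  intro t ht
  obtain ⟨t', A, -, hA⟩ := h t ((meets_region ht).mono hS)
  exact ⟨t', A, fun p => hA p (hS ⟨t, ht, p, rfl⟩)⟩

/-! ### From combinatorial agreement to metric agreement. -/

theorem one_lt_sqrt_two : (1 : ℝ) < √2 := by
  rw [Real.lt_sqrt] <;> norm_num

/-- An isomorphism of large combinatorial balls is an isometry of smaller metric balls. -/
theorem DiscAgree.contAgree {a b : PointedTiling κ} (ha : IsVertex a.x) {ε : ℝ} (hε : 0 < ε)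
    (hε' : 18 * ε < 1 / √2) (h : DiscAgree a b ε) : ContAgree a b (18 * ε) := by
  obtain ⟨φ, hcell, hdeg, hinj, hx⟩ := h
  obtain ⟨r, hr⟩ : ∃ r, r = 1 / (18 * ε) := ⟨_, rfl⟩
  have hr18 : 1 / ε = 18 * r := by rw [hr]; field_simp
  have hr1 : 1 < r := by
    rw [hr, lt_one_div one_pos (by positivity)]
    refine hε'.trans ?_
    rw [div_one, div_lt_one (by positivity)]
    exact one_lt_sqrt_two
  have hD := a.hasDistinctCorners
  have hpa := a.pathConnected
  have hpb := b.pathConnected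
  rw [hr18] at hcell hdeg hinj
  let P : Set a.L.T := {t | ∀ i : Fin 5, WithinEdgeDist a.x (vtx t i) (18 * r)}
  have hPS : region P ⊆ combBall a.x (18 * r) := subset_insert _ _
  -- Here `4 * (3 * r + 1 / 2) + 2 = 12 * r + 4 ≤ 18 * r - 2` because `r > 1`; this is the source of
  -- `18`. The spare `2` pays for the neighbouring tiles in `hstar`.
  have hnear : ∀ t p, affDist a.x (pt t p) ≤ 3 * r + 1 / 2 → ∀ k,
      WithinEdgeDist a.x (vtx t k : a.L.Point) (18 * r - 2) := by
    intro t p h k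
    obtain ⟨w, hw⟩ := hD.withinEdgeDist ha t p k
    exact ⟨w, by linarith⟩
  have hstar : ∀ s p, affDist a.x (pt s p) ≤ 3 * r + 1 / 2 →
      ∀ t i k, (vtx t i : a.L.Point) = vtx s k → t ∈ P := by
    intro s p h t i k hik j
    have h1 := hnear s p h k
    rw [← hik] at h1
    have h2 := WithinEdgeDist.tile hD h1 j
    rwa [sub_add_cancel] at h2
  have hP : ∀ t p, affDist a.x (pt t p) ≤ 3 * r + 1 / 2 → t ∈ P :=
    fun t p h => hstar t p h t 0 0 rfl
  have hball : ∀ y : a.L.Point, affDist a.x y ≤ 3 * r + 1 / 2 → y ∈ region P := by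
    intro y hy
    obtain ⟨t, p, rfl⟩ := exists_pt y
    exact ⟨t, hP t p hy, p, rfl⟩
  have hsub : affBall a.x r ⊆ combBall a.x (18 * r) := by
    intro y hy
    have hy' : affDist a.x y ≤ r := hy
    exact hPS (hball y (by linarith))
  have htile := isTileMapOn_of_isCellMapOn hcell hPS
  refine ⟨φ, ?_, ?_, ?_, ?_⟩
  · rw [← hr]
    intro t ht
    obtain ⟨t', A, hdec, hA⟩ := hcell t (ht.mono hsub)
    exact ⟨t', A, hdec, fun p hp => hA p (hsub hp)⟩
  · rw [← hr]
    exact fun y hy => hdeg y (hsub hy)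
  · rw [← hr]
    intro y hy z hz
    have hy' : affDist a.x y ≤ r := hy
    have hz' : affDist a.x z ≤ r := hz
    have hyz : affDist y z ≤ 2 * r := by
      refine le_of_forall_gt_imp_ge_of_dense fun l hl => ?_
      obtain ⟨l', hl', h'⟩ := hpa.exists_lt (show affDist a.x z < l - affDist a.x y by linarith)
      obtain ⟨l'', hl'', h''⟩ := hpa.exists_lt
        (show affDist a.x y < l - l' by linarith)
      linarith [affDist_le (h''.symm.trans h')]
    -- A path from `y` of length below `2 * r + 1 / 2` stays within `3 * r + 1 / 2` of the base
    -- vertex; the slack `1 / 2` allows for an infimum that is not attained.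
    have hle : affDist (φ y) (φ z) ≤ affDist y z := by
      refine le_of_forall_gt_imp_ge_of_dense fun l hl => ?_
      obtain ⟨l', hl', h'⟩ := hpa.exists_lt
        (lt_min hl (show affDist y z < 2 * r + 1 / 2 by linarith))
      have h1 := min_le_left l (2 * r + 1 / 2)
      have h2 := min_le_right l (2 * r + 1 / 2)
      linarith [affDist_le (htile.pathLength hpa hP h' (by linarith))]
    refine le_antisymm hle (le_of_forall_gt_imp_ge_of_dense fun l hl => ?_)
    obtain ⟨l', hl', h'⟩ := hpb.exists_lt
      (lt_min hl (show affDist (φ y) (φ z) < 2 * r + 1 / 2 by linarith))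
    have h1 := min_le_left l (2 * r + 1 / 2)
    have h2 := min_le_right l (2 * r + 1 / 2)
    obtain ⟨w, hw, hwz⟩ := htile.exists_pathLength (hinj.mono hPS)
      finite_tiles_of_firstCountable (fun u hu => hdeg u (hPS hu)) hpa hP hstar h' y rfl
      (by linarith)
    have hwP : w ∈ region P := hball w (by linarith [hpa.affDist_le_add (x := a.x) hw])
    obtain rfl := hinj (hPS hwP) (hPS (hball z (by linarith))) hwz
    linarith [affDist_le hw]
  · rw [hx, affDist_self]
    positivity

/-! ### Extension of maps from metric balls to combinatorial balls -/

theorem exists_apply_edgePt (A : PentSym) (j : Fin 5) {s : ℝ} (h0 : 0 ≤ s) (h1 : s ≤ 1) :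
    ∃ k s', 0 ≤ s' ∧ s' ≤ 1 ∧ (A : ℂ ≃ₗᵢ[ℝ] ℂ) (edgePt j s) = edgePt k s' ∧
      ((k = perm A j ∧ k + 1 = perm A (j + 1) ∧ s' = s) ∨
        (k = perm A (j + 1) ∧ k + 1 = perm A j ∧ s' = 1 - s)) := by
  rw [apply_edgePt]
  rcases perm_succ A j with h | h
  · exact ⟨perm A j, s, h0, h1, by rw [h, edgePt], Or.inl ⟨rfl, h.symm, rfl⟩⟩
  · refine ⟨perm A (j + 1), 1 - s, by linarith, by linarith, ?_, Or.inr ⟨rfl, h.symm, rfl⟩⟩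
    rw [h, edgePt]
    push_cast
    ring

/-- Agreement of `μ` with the tile map is asked only on the support, since for the base vertex only
one corner of its tile need be controlled. -/
theorem boundaryCoord_act {C C' : PentComplex} (hC : C.HasDistinctCorners) {t : C.T} {t' : C'.T}
    {A : PentSym} {p : pentagon} {c : C.V →₀ ℝ} (h : C.BoundaryCoord ⟨t, p⟩ c) {μ : C.V → C'.V}
    (hμ : ∀ i, C.vert t i ∈ c.support → μ (C.vert t i) = C'.vert t' (perm A i)) :
    C'.BoundaryCoord ⟨t', act A p⟩ (c.mapDomain μ) := by
  have hsum := h.eq_sum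
  obtain ⟨j, s, h0, h1, hp, hc⟩ := h
  obtain ⟨k, s', h0', h1', hk, hcase⟩ := exists_apply_edgePt A j h0 h1
  have hp' : (act A p : ℂ) = edgePt k s' := by
    rw [← hk]
    exact congrArg (A : ℂ ≃ₗᵢ[ℝ] ℂ) hp
  have hv : C.vert t j ≠ C.vert t (j + 1) := fun h => by
    have := hC t h
    exact (by decide : ∀ j : Fin 5, j ≠ j + 1) j this
  have e0 : c (C.vert t j) = 1 - s := by
    rw [hc, Finsupp.add_apply, Finsupp.single_eq_same, Finsupp.single_eq_of_ne hv, add_zero]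
  have e1 : c (C.vert t (j + 1)) = s := by
    rw [hc, Finsupp.add_apply, Finsupp.single_eq_same, Finsupp.single_eq_of_ne hv.symm, zero_add]
  have m0 : Finsupp.single (μ (C.vert t j)) (1 - s) =
      Finsupp.single (C'.vert t' (perm A j)) (1 - s) := by
    by_cases hs : 1 - s = 0
    · rw [hs, Finsupp.single_zero, Finsupp.single_zero]
    · rw [hμ]
      rwa [Finsupp.mem_support_iff, e0]
  have m1 : Finsupp.single (μ (C.vert t (j + 1))) s =
      Finsupp.single (C'.vert t' (perm A (j + 1))) s := by
    by_cases hs : s = 0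
    · rw [hs, Finsupp.single_zero, Finsupp.single_zero]
    · rw [hμ]
      rwa [Finsupp.mem_support_iff, e1]
  refine ⟨k, s', h0', h1', hp', ?_⟩
  simp only at hc ⊢
  rw [hc, Finsupp.mapDomain_add, Finsupp.mapDomain_single, Finsupp.mapDomain_single, m0, m1]
  rcases hcase with ⟨h, h', rfl⟩ | ⟨h, h', rfl⟩
  · rw [h', h]
  · rw [h', h, sub_sub_cancel, add_comm]

theorem exists_boundaryCoord_of_act {C C' : PentComplex} {t : C.T} {t' : C'.T}
    {A : PentSym} {p : pentagon} {c : C'.V →₀ ℝ} (h : C'.BoundaryCoord ⟨t', act A p⟩ c) :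
    ∃ c, C.BoundaryCoord ⟨t, p⟩ c := by
  obtain ⟨j, s, h0, h1, hp, -⟩ := h
  obtain ⟨k, s', h0', h1', hk, -⟩ := exists_apply_edgePt A⁻¹ j h0 h1
  refine ⟨_, k, s', h0', h1', ?_, rfl⟩
  change _ = edgePt k s'
  rw [← hk, edgePt, ← hp]
  exact congrArg Subtype.val (act_inv_act A p).symm

theorem exists_vtx_eq_of_pt_eq_vtx {C : PentComplex} {t s : C.T} {p : pentagon} {k : Fin 5}
    (h : (pt t p : C.Point) = vtx s k) : ∃ i, (vtx t i : C.Point) = vtx s k := by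
  rcases pt_eq_pt_iff.1 h with h | ⟨c, h1, h2⟩
  · obtain ⟨h1, -⟩ := Sigma.mk.inj_iff.1 h
    exact ⟨k, by rw [h1]⟩
  · obtain rfl := h2.unique (boundaryCoord_corner s k)
    obtain ⟨i, hi⟩ := h1.exists_vert_of_mem_support (w := C.vert s k) (by simp)
    exact ⟨i, vtx_eq_vtx_iff.2 hi⟩

/-- An isometric cell map of a metric ball extends to the smaller combinatorial balls. -/
theorem ContAgree.discAgree {a b : PointedTiling κ} (ha : IsVertex a.x) (hb : IsVertex b.x)
    {ε ε' : ℝ} (hε : 0 < ε) (hε1 : ε < 1) (hεε' : ε < ε') (h : ContAgree a b ε) :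
    DiscAgree a b ε' := by
  classical
  obtain ⟨φ, hcell, hdeg, hiso, hx⟩ := h
  have hmr : 1 / ε' < 1 / ε := one_div_lt_one_div_of_lt hε hεε'
  have hr0 : 0 < 1 / ε := by positivity
  unfold DiscAgree
  generalize 1 / ε = r at *
  generalize 1 / ε' = m at *
  have hD := a.hasDistinctCorners
  have hDb := b.hasDistinctCorners
  have hpa := a.pathConnected
  have hpb := b.pathConnected
  let B : Set a.L.Point := affBall a.x r
  let P : Set a.L.T := {t | ∀ i : Fin 5, WithinEdgeDist a.x (vtx t i) m}
  -- The gap `r - m > 0`, due to `ε < ε'`, leaves room around each corner for interior points of the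
  -- tile.
  have hnear : ∀ (t : a.L.T) (i : Fin 5) (p : pentagon), affDist a.x (vtx t i) ≤ m →
      dist p (cornerPt i) < r - m → pt t p ∈ B := by
    intro t i p h hp
    have h1 := hpa.affDist_le_add (x := a.x) (PathLength.single t (cornerPt i) p)
    rw [dist_comm] at hp
    change affDist a.x (pt t p) ≤ r
    change affDist a.x (pt t (cornerPt i)) ≤ m at h
    linarith
  have hPB : ∀ t ∈ P, ∀ i, (vtx t i : a.L.Point) ∈ B := fun t ht i =>
    hnear t i _ (ht i).affDist_le (by rw [dist_self]; linarith)
  have hPm : ∀ t ∈ P, Meets t B := by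
    intro t ht
    obtain ⟨p, hp, hd⟩ := exists_interior_near_corner 0 (sub_pos.2 hmr)
    exact ⟨p, hp, hnear t 0 p (ht 0).affDist_le hd⟩
  have hxB : a.x ∈ B := by
    change affDist a.x a.x ≤ r
    rw [affDist_self]
    exact hr0.le
  obtain ⟨t₀, i₀, hx₀⟩ := ha
  have ht₀ : Meets t₀ B := by
    obtain ⟨p, hp, hd⟩ := exists_interior_near_corner i₀ hr0
    refine ⟨p, hp, ?_⟩
    have h1 := affDist_le (PathLength.single t₀ (cornerPt i₀) p)
    change affDist a.x (pt t₀ p) ≤ r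
    rw [← hx₀]
    rw [dist_comm] at hd
    exact h1.trans hd.le
  have hne : Nonempty b.L.T := ⟨(exists_pt b.x).choose⟩
  choose! τ A hdec hτ using hcell
  have hτv : ∀ t, Meets t B → ∀ i, (vtx t i : a.L.Point) ∈ B →
      φ (vtx t i) = vtx (τ t) (perm (A t) i) := by
    intro t ht i hi
    rw [← pt_act_cornerPt]
    exact hτ t ht _ hi
  let N : Set a.L.V := {w | ∃ t, Meets t B ∧ ∃ i, (vtx t i : a.L.Point) ∈ B ∧ a.L.vert t i = w}
  -- The vertex map is independent of the tile chosen because `φ` is a single map on points; its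
  -- fallback value plays no role.
  obtain ⟨μ, hμ⟩ : ∃ μ : a.L.V → b.L.V, ∀ t, Meets t B → ∀ i, (vtx t i : a.L.Point) ∈ B →
      μ (a.L.vert t i) = b.L.vert (τ t) (perm (A t) i) := by
    refine ⟨fun w => if h : ∃ s : a.L.T × Fin 5, Meets s.1 B ∧ (vtx s.1 s.2 : a.L.Point) ∈ B ∧
      a.L.vert s.1 s.2 = w then b.L.vert (τ h.choose.1) (perm (A h.choose.1) h.choose.2)
      else b.L.vert (τ t₀) 0, fun t ht i hi => ?_⟩
    have h : ∃ s : a.L.T × Fin 5, Meets s.1 B ∧ (vtx s.1 s.2 : a.L.Point) ∈ B ∧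
      a.L.vert s.1 s.2 = a.L.vert t i := ⟨(t, i), ht, hi, rfl⟩
    simp only [dif_pos h]
    obtain ⟨h1, h2, h3⟩ := h.choose_spec
    rw [← vtx_eq_vtx_iff, ← hτv _ h1 _ h2, ← hτv _ ht _ hi, vtx_eq_vtx_iff.2 h3]
  have hμN : InjOn μ N := by
    rintro _ ⟨t, ht, i, hi, rfl⟩ _ ⟨s, hs, j, hj, rfl⟩ h
    rw [hμ t ht i hi, hμ s hs j hj, ← vtx_eq_vtx_iff, ← hτv t ht i hi, ← hτv s hs j hj] at h
    rw [← vtx_eq_vtx_iff]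
    refine eq_of_affDist_lt_one hD hpa ⟨t, i, rfl⟩ ⟨s, j, rfl⟩ ?_
    rw [← hiso _ hi _ hj, h, affDist_self]
    exact one_pos
  have hcoord : ∀ t ∈ P, ∀ p c, a.L.BoundaryCoord ⟨t, p⟩ c →
      b.L.BoundaryCoord ⟨τ t, act (A t) p⟩ (c.mapDomain μ) ∧ (c.support : Set a.L.V) ⊆ N := by
    intro t ht p c hc
    refine ⟨boundaryCoord_act hD hc fun i _ => hμ t (hPm t ht) i (hPB t ht i), fun w hw => ?_⟩
    obtain ⟨i, hi⟩ := hc.exists_vert_of_mem_support hw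
    exact ⟨t, hPm t ht, i, hPB t ht i, hi⟩
  -- Keeping `φ` on `B` lets degrees and the base point be inherited directly; the last branch lies
  -- outside the combinatorial ball.
  let ψ : a.L.Point → b.L.Point := fun x => if x ∈ B then φ x else
    if h : ∃ s : a.L.T × pentagon, s.1 ∈ P ∧ pt s.1 s.2 = x then
      pt (τ h.choose.1) (act (A h.choose.1) h.choose.2) else φ x
  have hψB : ∀ x ∈ B, ψ x = φ x := fun x hx => if_pos hx
  have hψP : ∀ t ∈ P, ∀ p, ψ (pt t p) = pt (τ t) (act (A t) p) := by
    intro t ht p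
    by_cases hB : (pt t p : a.L.Point) ∈ B
    · rw [hψB _ hB, hτ t (hPm t ht) p hB]
    have h : ∃ s : a.L.T × pentagon, s.1 ∈ P ∧ (pt s.1 s.2 : a.L.Point) = pt t p :=
      ⟨(t, p), ht, rfl⟩
    simp only [ψ, if_neg hB, dif_pos h]
    obtain ⟨h1, h2⟩ := h.choose_spec
    rcases pt_eq_pt_iff.1 h2 with h3 | ⟨c, h3, h4⟩
    · obtain ⟨h4, h5⟩ := Sigma.mk.inj_iff.1 h3
      rw [h4, eq_of_heq h5]
    · exact Quot.sound ⟨_, (hcoord _ h1 _ _ h3).1, (hcoord t ht _ _ h4).1⟩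
  have hφx : φ a.x = vtx (τ t₀) (perm (A t₀) i₀) := by
    have h := hτv t₀ ht₀ i₀
    rw [hx₀] at h
    exact h hxB
  -- For small `m` the base vertex may lie in no tile of `P`. It is then represented in `t₀`, where
  -- it is at least a boundary point.
  have hrep : ∀ x ∈ combBall a.x m, ∃ t p, pt t p = x ∧ ψ x = pt (τ t) (act (A t) p) ∧
      (∀ c, a.L.BoundaryCoord ⟨t, p⟩ c →
        b.L.BoundaryCoord ⟨τ t, act (A t) p⟩ (c.mapDomain μ) ∧ (c.support : Set a.L.V) ⊆ N) ∧
      (t ∈ P ∨ ∃ c, a.L.BoundaryCoord ⟨t, p⟩ c) := by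
    rintro x (rfl | ⟨t, ht, p, rfl⟩)
    · have hvB : (vtx t₀ i₀ : a.L.Point) ∈ B := by rwa [hx₀]
      refine ⟨t₀, cornerPt i₀, hx₀, ?_, ?_, Or.inr ⟨_, boundaryCoord_corner t₀ i₀⟩⟩
      · rw [hψB _ hxB, hφx, pt_act_cornerPt]
      · intro c hc
        obtain rfl := hc.unique (boundaryCoord_corner t₀ i₀)
        have hs : ∀ w ∈ (Finsupp.single (a.L.vert t₀ i₀) (1 : ℝ)).support,
            w = a.L.vert t₀ i₀ := by
          intro w hw
          by_contra hne
          exact (Finsupp.mem_support_iff.1 hw) (Finsupp.single_eq_of_ne hne)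
        refine ⟨boundaryCoord_act hD hc fun i hi => ?_, fun w hw => ?_⟩
        · rw [hD t₀ (hs _ hi)]
          exact hμ t₀ ht₀ i₀ hvB
        · exact ⟨t₀, ht₀, i₀, hvB, (hs w hw).symm⟩
    · exact ⟨t, p, rfl, hψP t ht p, hcoord t ht p, Or.inl ht⟩
  -- If two tiles have the same image, an interior point near a corner of one and a point of the
  -- other have equal images, so their distance is zero.
  have hτinj : InjOn τ P := by
    intro t ht s hs hts
    obtain ⟨p, hp, hd⟩ := exists_interior_near_corner 0 (sub_pos.2 hmr)
    have hpB := hnear t 0 p (ht 0).affDist_le hd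
    let q : pentagon := act (A s)⁻¹ (act (A t) p)
    have hqB : (pt s q : a.L.Point) ∈ B := by
      refine hnear s (perm (A s)⁻¹ (perm (A t) 0)) q (hs _).affDist_le ?_
      rw [← act_cornerPt, ← act_cornerPt, dist_act, dist_act]
      exact hd
    refine eq_of_affDist_eq_zero hpa hp (q := q) ?_
    rw [← hiso _ hpB _ hqB, hτ t (hPm t ht) p hpB, hτ s (hPm s hs) q hqB, act_act_inv, hts,
      affDist_self]
  refine ⟨ψ, ?_, ?_, ?_, ?_⟩
  · rintro t ⟨p, hp, hpS⟩
    have ht : t ∈ P := by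
      rcases hpS with h | ⟨s, hs, q, h⟩
      · exact absurd (hx₀.trans h.symm) (vtx_ne_pt_of_mem_interior hp)
      · rw [(eq_of_pt_eq_of_mem_interior hp h.symm).1]
        exact hs
    exact ⟨τ t, A t, hdec t (hPm t ht), fun p _ => hψP t ht p⟩
  · rintro y hy ⟨s, k, rfl⟩
    have hyB : (vtx s k : a.L.Point) ∈ B := by
      rcases hy with h | ⟨t, ht, p, h⟩
      · rw [h]
        exact hxB
      · obtain ⟨i, hi⟩ := exists_vtx_eq_of_pt_eq_vtx h
        rw [← hi]
        exact hPB t ht i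
    rw [hψB _ hyB]
    exact hdeg _ hyB ⟨s, k, rfl⟩
  · intro x hx y hy hxy
    obtain ⟨t, p, rfl, hψt, hct, ht⟩ := hrep x hx
    obtain ⟨s, q, rfl, hψs, hcs, hs⟩ := hrep y hy
    rw [hψt, hψs] at hxy
    -- Boundary points are separated by the injectivity of `μ` on vertices, the remaining points by
    -- that of `τ` on tiles.
    have hboth : ∀ c c', a.L.BoundaryCoord ⟨t, p⟩ c → a.L.BoundaryCoord ⟨s, q⟩ c' →
        (pt t p : a.L.Point) = pt s q := by
      intro c c' hc hc'
      obtain ⟨h1, h2⟩ := hct c hc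
      obtain ⟨h3, h4⟩ := hcs c' hc'
      have heq : c.mapDomain μ = c'.mapDomain μ := by
        rcases pt_eq_pt_iff.1 hxy with h | ⟨d, h5, h6⟩
        · rw [h] at h1
          exact h1.unique h3
        · rw [h1.unique h5, h3.unique h6]
      have hcc : c = c' := Finsupp.mapDomain_injOn N hμN h2 h4 heq
      exact Quot.sound ⟨c, hc, hcc ▸ hc'⟩
    rcases pt_eq_pt_iff.1 hxy with h | ⟨d, h5, h6⟩
    · by_cases hc : ∃ c, a.L.BoundaryCoord ⟨t, p⟩ c
      · obtain ⟨c, hc⟩ := hc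
        have h1 := (hct c hc).1
        rw [h] at h1
        obtain ⟨c', hc'⟩ := exists_boundaryCoord_of_act (t := s) h1
        exact hboth c c' hc hc'
      by_cases hc' : ∃ c, a.L.BoundaryCoord ⟨s, q⟩ c
      · obtain ⟨c, hc'⟩ := hc'
        have h1 := (hcs c hc').1
        rw [← h] at h1
        exact absurd (exists_boundaryCoord_of_act (t := t) h1) hc
      obtain ⟨h1, h2⟩ := Sigma.mk.inj_iff.1 h
      obtain rfl := hτinj (ht.resolve_right hc) (hs.resolve_right hc') h1
      have h3 := congrArg (act (A t)⁻¹) (eq_of_heq h2)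
      rw [act_inv_act, act_inv_act] at h3
      rw [h3]
    · obtain ⟨c, hc⟩ := exists_boundaryCoord_of_act (t := t) h5
      obtain ⟨c', hc'⟩ := exists_boundaryCoord_of_act (t := s) h6
      exact hboth c c' hc hc'
  · rw [hψB _ hxB]
    exact eq_of_affDist_lt_one hDb hpb ⟨_, _, hφx.symm⟩ hb (hx.trans_lt hε1)

/-! ### Comparison of the two metrics -/

theorem dDisc_le_dCont (ξ η : Xi κ) : dDisc ξ η ≤ dCont (ξ : Omega κ) (η : Omega κ) := by
  have hbdd : BddBelow (insert (1 / √2) {ε : ℝ | 0 < ε ∧ ∃ a b : PointedTiling κ,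
      cls a = ξ ∧ cls b = η ∧ DiscAgree a b ε ∧ DiscAgree b a ε}) := by
    refine ⟨0, ?_⟩
    rintro ε (rfl | ⟨hε, -⟩)
    · positivity
    · exact hε.le
  have htop : dDisc ξ η ≤ 1 / √2 := csInf_le hbdd (mem_insert _ _)
  refine le_csInf (insert_nonempty _ _) ?_
  rintro ε (rfl | ⟨hε, a, b, ha, hb, hab, hba⟩)
  · exact htop
  by_cases hε1 : ε < 1
  · have hva : IsVertex a.x := isVertex_of_mem_Xi (by rw [ha]; exact ξ.2)
    have hvb : IsVertex b.x := isVertex_of_mem_Xi (by rw [hb]; exact η.2)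
    -- The strict loss from `ε` to `ε'` disappears in the infimum.
    refine le_of_forall_gt_imp_ge_of_dense fun ε' hε' => ?_
    exact csInf_le hbdd (Or.inr ⟨hε.trans hε', a, b, ha, hb,
      hab.discAgree hva hvb hε hε1 hε', hba.discAgree hvb hva hε hε1 hε'⟩)
  · refine htop.trans (le_trans ?_ (not_lt.1 hε1))
    rw [div_le_one (by positivity)]
    exact one_lt_sqrt_two.le

theorem dCont_le_mul_dDisc (ξ η : Xi κ) :
    dCont (ξ : Omega κ) (η : Omega κ) ≤ 18 * dDisc ξ η := by
  have hbdd : BddBelow (insert (1 / √2) {ε : ℝ | 0 < ε ∧ ∃ a b : PointedTiling κ,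
      cls a = ξ ∧ cls b = η ∧ ContAgree a b ε ∧ ContAgree b a ε}) := by
    refine ⟨0, ?_⟩
    rintro ε (rfl | ⟨hε, -⟩)
    · positivity
    · exact hε.le
  have htop : dCont (ξ : Omega κ) (η : Omega κ) ≤ 1 / √2 := csInf_le hbdd (mem_insert _ _)
  rw [← div_le_iff₀' (by norm_num)]
  refine le_csInf (insert_nonempty _ _) ?_
  intro ε hmem
  rw [div_le_iff₀' (by norm_num)]
  -- Otherwise the cap `1 / √2` on `dCont` already gives the bound.
  by_cases hε1 : 18 * ε < 1 / √2
  · rcases hmem with rfl | ⟨hε, a, b, ha, hb, hab, hba⟩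
    · have : 0 < 1 / √2 := by positivity
      linarith
    have hva : IsVertex a.x := isVertex_of_mem_Xi (by rw [ha]; exact ξ.2)
    have hvb : IsVertex b.x := isVertex_of_mem_Xi (by rw [hb]; exact η.2)
    exact csInf_le hbdd (Or.inr ⟨by positivity, a, b, ha, hb,
      hab.contAgree hva hε hε1, hba.contAgree hvb hε hε1⟩)
  · exact htop.trans (not_lt.1 hε1)

end PentHull

end

theorem theoremt {D : Type*} [MulAction PentHull.PentSym D] (κ : PentHull.K.T → D)
    (ξ η : PentHull.Xi κ) :
    PentHull.dDisc ξ η ≤ PentHull.dCont (ξ : PentHull.Omega κ) (η : PentHull.Omega κ) ∧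
    PentHull.dCont (ξ : PentHull.Omega κ) (η : PentHull.Omega κ) ≤ 18 * PentHull.dDisc ξ η :=
  ⟨PentHull.dDisc_le_dCont ξ η, PentHull.dCont_le_mul_dDisc ξ η⟩
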